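/- Let $d\in\mathbf N$, $s>1$, $\phi(x)=\pi^{-d/4}e^{-|x|^2/2}$ on $\mathbf R^d$, and let $f\in\mathcal S_{1/2}'(\mathbf R^d)$, the topological dual of the Gelfand–Shilov space $\mathcal S_{1/2}(\mathbf R^d)$ of all smooth $g$ such that, for some $C,h>0$, $|x|^{k}\,\|D^ng(x)\|\le C h^{k+n}(k!\,n!)^{1/2}$ for all $k,n\in\mathbf N$ and $x\in\mathbf R^d$. Let $V_\phi g(x,\xi)=\int_{\mathbf R^d} g(t)\overline{\phi(t-x)}e^{-i\langle t,\xi\rangle}\,dt$ be the short-time Fourier transform, and let $V_\phi^*$ be its adjoint: $f=V_\phi^*F$ means that $(f,g)=(F,V_\phi g)$ for every $g\in\mathcal S_{1/2}(\mathbf R^d)$, where $(u,v)=\langle u,\overline v\rangle$. For $r\in\mathbf R_+^d$ let $\overline{D_r(0)}=\{z\in\mathbf C^d : |z_j|\le r_j,\ j=1,\dots,d\}$ and let $\chi_r$ be its characteristic function, $\mathbf C^d\simeq\mathbf R^{2d}$ through $x+i\xi\leftrightarrow(x,\xi)$. Let $\mathcal E_s'(\mathbf R^{2d})$ be the space of compactly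 supported Gevrey distributions of order $s$, that is, the dual of the space $\mathcal E_s(\mathbf R^{2d})$ of smooth functions $\psi$ such that for every compact $K$ there are $C,h>0$ with $\|D^n\psi\|\le Ch^n(n!)^s$ on $K$ for all $n$. Let $h_\alpha(x)=\pi^{-d/4}(-1)^{|\alpha|}(2^{|\alpha|}\alpha!)^{-1/2}e^{|x|^2/2}\partial^\alpha e^{-|x|^2}$, $\alpha\in\mathbf N^d$, be the Hermite functions, and let the Pilipović space $\mathcal H_{\flat_1}(\mathbf R^d)$ consist of all $f\in L^2(\mathbf R^d)$ for which there are $r\in\mathbf R_+^d$ and $C>0$ with $|(f,h_\alpha)_{L^2}|\le C r^\alpha\alpha!^{-1/2}$ for all $\alpha\in\mathbf N^d$. Then the following conditions are equivalent: (1) $f\in\mathcal H_{\flat_1}(\mathbf R^d)$; (2) $f=V_\phi^*F$ for some $F\in\mathcal E_s'(\mathbf R^{2d})$; (3) $f=V_\phi^*F$ for some compactly supported $F\in L^\infty(\mathbf R^{2d})$ (that is, $f$ belongs to Gröchenig's test function space $\mathcal S_C(\mathbf R^d)$); (4) $f=V_\phi^*F$ for some compactly supported $F\in L^\infty(\mathbf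 R^{2d})$ of the form $F(x,\xi)=F_0(x-i\xi)e^{-i\langle x,\xi\rangle}\chi_r(x,\xi)$, for some $r\in\mathbf R_+^d$ and some $F_0$ analytic in a neighbourhood of $\overline{D_r(0)}$. -/

import Mathlib

open MeasureTheory
open scoped ContDiff ComplexConjugate Nat

/-- The space `ℝ^d` with its Euclidean norm and Lebesgue measure. Phase space `ℝ^{2d}` is
`RSp d × RSp d`, with points `(x, ξ)` and the product (Lebesgue) measure. -/
abbrev RSp (d : ℕ) : Type := EuclideanSpace ℝ (Fin d)

/-! ### Gevrey functions and compactly supported Gevrey distributions -/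

section Gevrey

variable {E : Type*} [NormedAddCommGroup E] [NormedSpace ℝ E]

/-- `‖D^n f(x)‖ ≤ M h^n (n!)^s` for all `n` and all `x ∈ K`. -/
def GevreyBoundOn (s : ℝ) (K : Set E) (h M : ℝ) (f : E → ℂ) : Prop :=
  ∀ (n : ℕ), ∀ x ∈ K, ‖iteratedFDeriv ℝ n f x‖ ≤ M * h ^ n * (n ! : ℝ) ^ s

/-- `f` is smooth and of (Roumieu) Gevrey regularity `s`: on each compact set,
`‖D^n f‖ ≤ M h^n (n!)^s` for some `h` and `M`. -/
def IsGevrey (s : ℝ) (f : E → ℂ) : Prop :=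
  ContDiff ℝ ∞ f ∧
    ∀ K : Set E, IsCompact K → ∃ h M : ℝ, 0 < h ∧ 0 ≤ M ∧ GevreyBoundOn s K h M f

/-- `‖x‖^k ‖D^n f(x)‖ ≤ M h^{k+n} (k! n!)^s` for all `k`, `n` and `x`. -/
def GelfandShilovBound (s h M : ℝ) (f : E → ℂ) : Prop :=
  ∀ (k n : ℕ) (x : E),
    ‖x‖ ^ k * ‖iteratedFDeriv ℝ n f x‖ ≤ M * h ^ (k + n) * ((k ! : ℝ) * (n ! : ℝ)) ^ s

/-- `f` belongs to the Fourier invariant Gelfand–Shilov space `𝓢_s` (Roumieu type). -/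
def IsGelfandShilov (s : ℝ) (f : E → ℂ) : Prop :=
  ContDiff ℝ ∞ f ∧ ∃ h M : ℝ, 0 < h ∧ 0 ≤ M ∧ GelfandShilovBound s h M f

theorem norm_iteratedFDeriv_add_le_of_smooth {f g : E → ℂ} (hf : ContDiff ℝ ∞ f)
    (hg : ContDiff ℝ ∞ g) (n : ℕ) (x : E) :
    ‖iteratedFDeriv ℝ n (f + g) x‖ ≤
      ‖iteratedFDeriv ℝ n f x‖ + ‖iteratedFDeriv ℝ n g x‖ := by
  rw [iteratedFDeriv_add_apply (hf.contDiffAt.of_le (by exact_mod_cast le_top))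
    (hg.contDiffAt.of_le (by exact_mod_cast le_top))]
  exact norm_add_le _ _

theorem norm_iteratedFDeriv_smul_of_smooth {f : E → ℂ} (hf : ContDiff ℝ ∞ f)
    (c : ℂ) (n : ℕ) (x : E) :
    ‖iteratedFDeriv ℝ n (c • f) x‖ = ‖c‖ * ‖iteratedFDeriv ℝ n f x‖ := by
  rw [iteratedFDeriv_const_smul_apply (hf.contDiffAt.of_le (by exact_mod_cast le_top)),
    norm_smul]

/-- The space `𝓔_s(E)` of Gevrey functions of order `s`. -/
def gevreySpace (s : ℝ) (E : Type*) [NormedAddCommGroup E] [NormedSpace ℝ E] :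
    Submodule ℂ (E → ℂ) where
  carrier := {f | IsGevrey s f}
  zero_mem' := by
    refine ⟨contDiff_const, fun K _ => ⟨1, 0, one_pos, le_rfl, fun n x _ => ?_⟩⟩
    simp
  add_mem' := by
    rintro f g ⟨hf, hf'⟩ ⟨hg, hg'⟩
    refine ⟨hf.add hg, fun K hK => ?_⟩
    obtain ⟨h₁, M₁, hh₁, hM₁, b₁⟩ := hf' K hK
    obtain ⟨h₂, M₂, hh₂, hM₂, b₂⟩ := hg' K hK
    refine ⟨max h₁ h₂, M₁ + M₂, lt_max_of_lt_left hh₁, by positivity, fun n x hx => ?_⟩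
    refine (norm_iteratedFDeriv_add_le_of_smooth hf hg n x).trans ?_
    refine (add_le_add (b₁ n x hx) (b₂ n x hx)).trans ?_
    rw [add_mul, add_mul]
    gcongr
    · exact le_max_left _ _
    · exact le_max_right _ _
  smul_mem' := by
    rintro c f ⟨hf, hf'⟩
    refine ⟨contDiff_const.smul hf, fun K hK => ?_⟩
    obtain ⟨h₁, M₁, hh₁, hM₁, b₁⟩ := hf' K hK
    refine ⟨h₁, ‖c‖ * M₁, hh₁, by positivity, fun n x hx => ?_⟩
    rw [norm_iteratedFDeriv_smul_of_smooth hf, mul_assoc, mul_assoc]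
    rw [← mul_assoc M₁]
    gcongr
    exact b₁ n x hx

/-- The space `𝓔_s'(E)` of compactly supported Gevrey distributions of order `s`: the
topological dual of `𝓔_s(E)`. As `𝓔_s(E)` is the projective limit over compact `K`, and for each
`K` the inductive limit over `h > 0`, of the spaces normed by
`sup_{n, x ∈ K} ‖D^n f(x)‖ / (h^n (n!)^s)`, a linear form is continuous when, for some `K`, it is
bounded with respect to each of these norms. -/
def gevreyDual (s : ℝ) (E : Type*) [NormedAddCommGroup E] [NormedSpace ℝ E] :
    Set (Module.Dual ℂ (gevreySpace s E)) :=
  {F | ∃ K : Set E, IsCompact K ∧ ∀ h : ℝ, 0 < h → ∃ C : ℝ,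
    ∀ (f : gevreySpace s E) (M : ℝ), 0 ≤ M → GevreyBoundOn s K h M (f : E → ℂ) →
      ‖F f‖ ≤ C * M}

/-- The Gelfand–Shilov space `𝓢_s(E)`. -/
def gelfandShilov (s : ℝ) (E : Type*) [NormedAddCommGroup E] [NormedSpace ℝ E] :
    Submodule ℂ (E → ℂ) where
  carrier := {f | IsGelfandShilov s f}
  zero_mem' := by
    refine ⟨contDiff_const, 1, 0, one_pos, le_rfl, fun k n x => ?_⟩
    simp
  add_mem' := by
    rintro f g ⟨hf, h₁, M₁, hh₁, hM₁, b₁⟩ ⟨hg, h₂, M₂, hh₂, hM₂, b₂⟩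
    refine ⟨hf.add hg, max h₁ h₂, M₁ + M₂, lt_max_of_lt_left hh₁, by positivity,
      fun k n x => ?_⟩
    refine (mul_le_mul_of_nonneg_left (norm_iteratedFDeriv_add_le_of_smooth hf hg n x)
      (by positivity)).trans ?_
    rw [mul_add]
    refine (add_le_add (b₁ k n x) (b₂ k n x)).trans ?_
    rw [add_mul, add_mul]
    gcongr
    · exact le_max_left _ _
    · exact le_max_right _ _
  smul_mem' := by
    rintro c f ⟨hf, h₁, M₁, hh₁, hM₁, b₁⟩
    refine ⟨contDiff_const.smul hf, h₁, ‖c‖ * M₁, hh₁, by positivity, fun k n x => ?_⟩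
    rw [norm_iteratedFDeriv_smul_of_smooth hf, mul_left_comm, mul_assoc ‖c‖, mul_assoc ‖c‖]
    exact mul_le_mul_of_nonneg_left (b₁ k n x) (norm_nonneg c)

/-- The topological dual `𝓢_s'(E)`: as `𝓢_s(E)` is the inductive limit over `h > 0` of the
spaces normed by `sup ‖x‖^k ‖D^n f(x)‖ / (h^{k+n} (k! n!)^s)`, a linear form is continuous
when it is bounded with respect to each of these norms. -/
def gelfandShilovDual (s : ℝ) (E : Type*) [NormedAddCommGroup E] [NormedSpace ℝ E] :
    Set (Module.Dual ℂ (gelfandShilov s E)) :=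
  {u | ∀ h : ℝ, 0 < h → ∃ C : ℝ, ∀ (f : gelfandShilov s E) (M : ℝ), 0 ≤ M →
    GelfandShilovBound s h M (f : E → ℂ) → ‖u f‖ ≤ C * M}

/-- The complex conjugate of an element of `𝓢_s`. -/
def gelfandShilovConj {s : ℝ} (f : gelfandShilov s E) : gelfandShilov s E :=
  ⟨fun x => conj ((f : E → ℂ) x), by
    obtain ⟨hf, h₁, M₁, hh₁, hM₁, b₁⟩ := f.2
    refine ⟨Complex.conjLIE.contDiff.comp hf, h₁, M₁, hh₁, hM₁, fun k n x => ?_⟩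
    have := Complex.conjLIE.norm_iteratedFDeriv_comp_left (f : E → ℂ) x n
    have e : (fun x => conj ((f : E → ℂ) x)) = Complex.conjLIE ∘ (f : E → ℂ) := rfl
    rw [e, this]
    exact b₁ k n x⟩

end Gevrey

noncomputable section

/-! ### The short-time Fourier transform with Gaussian window and its adjoint -/

/-- The window `φ(x) = π^{-d/4} e^{-|x|²/2}`. -/
def gaussianWindow (d : ℕ) (x : RSp d) : ℂ :=
  ((Real.pi ^ (-(d : ℝ) / 4) * Real.exp (-‖x‖ ^ 2 / 2) : ℝ) : ℂ)

/-- The short-time Fourier transform with window `φ = w`,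
`V_φ f(x, ξ) = ∫ f(t) conj(φ(t - x)) e^{-i⟨t, ξ⟩} dt`. -/
def stft {d : ℕ} (w f : RSp d → ℂ) (p : RSp d × RSp d) : ℂ :=
  ∫ t : RSp d, f t * conj (w (t - p.1)) * Complex.exp (-Complex.I * (inner ℝ t p.2 : ℝ))

/-- `f = V_φ^* F`, `φ = w`, for a Gevrey distribution `F` on `ℝ^{2d}` and `f ∈ 𝓢_{1/2}'(ℝ^d)`: for all
`g ∈ 𝓢_{1/2}(ℝ^d)` one has `(f, g) = (F, V_φ g)`, where `(u, v) = ⟨u, conj v⟩`. Here `conj (V_φ g)`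
has to be an element of `𝓔_s`. -/
def IsStftAdjoint {d : ℕ} {s : ℝ} (w : RSp d → ℂ)
    (F : Module.Dual ℂ (gevreySpace s (RSp d × RSp d)))
    (f : Module.Dual ℂ (gelfandShilov (1 / 2) (RSp d))) : Prop :=
  ∀ g : gelfandShilov (1 / 2) (RSp d), ∃ G : gevreySpace s (RSp d × RSp d),
    (∀ p, (G : RSp d × RSp d → ℂ) p = conj (stft w (g : RSp d → ℂ) p)) ∧
      f (gelfandShilovConj g) = F G

/-- `f = V_φ^* F`, `φ = w`, for a function `F` on `ℝ^{2d}`: for all `g ∈ 𝓢_{1/2}(ℝ^d)` one has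
`(f, g) = (F, V_φ g)`, the right hand side being the `L²` pairing. -/
def IsStftAdjointFun {d : ℕ} (w : RSp d → ℂ) (F : RSp d × RSp d → ℂ)
    (f : Module.Dual ℂ (gelfandShilov (1 / 2) (RSp d))) : Prop :=
  ∀ g : gelfandShilov (1 / 2) (RSp d),
    f (gelfandShilovConj g) = ∫ p : RSp d × RSp d, F p * conj (stft w (g : RSp d → ℂ) p)

/-- `F ∈ L^∞ ∩ 𝓔'`. -/
def IsBoundedCompactlySupported {d : ℕ} (F : RSp d × RSp d → ℂ) : Prop :=
  MemLp F ⊤ volume ∧ HasCompactSupport F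

/-! ### Hermite functions and the Pilipović spaces -/

/-- The Hermite function `h_α(x) = π^{-d/4} (-1)^{|α|} (2^{|α|} α!)^{-1/2} e^{|x|²/2}
(∂^α e^{-|x|²})`, where `∂^α e^{-|x|²}` is written as the product of the `(d/dx_j)^{α_j} e^{-x_j²}`. -/
def hermiteFun {d : ℕ} (α : Fin d → ℕ) (x : RSp d) : ℝ :=
  Real.pi ^ (-(d : ℝ) / 4) * (-1) ^ (∑ j, α j) *
    ((2 : ℝ) ^ (∑ j, α j) * ∏ j, ((α j)! : ℝ)) ^ (-(1 / 2) : ℝ) *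
    Real.exp (‖x‖ ^ 2 / 2) *
    ∏ j, iteratedDeriv (α j) (fun t : ℝ => Real.exp (-t ^ 2)) (x j)

/-- The Hermite coefficient `c_h(f, α) = (f, h_α)_{L²}` (the Hermite functions are real). -/
def hermiteCoeff {d : ℕ} (f : RSp d → ℂ) (α : Fin d → ℕ) : ℂ :=
  ∫ x : RSp d, f x * (hermiteFun α x : ℂ)

/-- `f ∈ 𝓗_{♭_σ}(ℝ^d)`: `f ∈ L²` and, for some `r ∈ ℝ_+^d`,
`|c_h(f, α)| ≤ C r^α α!^{-1/(2σ)}`. -/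
def IsPilipovicFlat {d : ℕ} (σ : ℝ) (f : RSp d → ℂ) : Prop :=
  MemLp f 2 volume ∧ ∃ r : Fin d → ℝ, (∀ j, 0 < r j) ∧ ∃ C : ℝ, ∀ α : Fin d → ℕ,
    ‖hermiteCoeff f α‖ ≤ C * ((∏ j, r j ^ α j) * (∏ j, ((α j)! : ℝ)) ^ (-(1 / (2 * σ))))

/-- The distribution `f ∈ 𝓢_{1/2}'(ℝ^d)` is (given by) an element of `𝓗_{♭_σ}(ℝ^d)`. -/
def MemPilipovicFlat {d : ℕ} (σ : ℝ) (f : Module.Dual ℂ (gelfandShilov (1 / 2) (RSp d))) : Prop :=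
  ∃ f₀ : RSp d → ℂ, IsPilipovicFlat σ f₀ ∧
    ∀ g : gelfandShilov (1 / 2) (RSp d), f g = ∫ x : RSp d, f₀ x * (g : RSp d → ℂ) x

/-! ### Polydiscs -/

/-- The closed polydisc with centre `0` and radii `r_j`. -/
def closedPolydisc {d : ℕ} (r : Fin d → ℝ) : Set (Fin d → ℂ) :=
  {z | ∀ j, ‖z j‖ ≤ r j}

/-- The characteristic function `χ_r(x, ξ)` of the closed polydisc, under
`(x, ξ) ↦ x + iξ`. -/
def polydiscChar {d : ℕ} (r : Fin d → ℝ) (p : RSp d × RSp d) : ℂ :=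
  (closedPolydisc r).indicator (fun _ => (1 : ℂ)) (fun j => (p.1 j : ℂ) + Complex.I * (p.2 j : ℂ))

end

/-!
Write `z = x + iξ`. For the window `φ` the conjugate of `V_φ g` is the Laplace transform
`e^{-|x|²/2} ∫ conj (g t) φ(t) e^{⟨t, z⟩} dt`, and for `g = h_α` this is a multiple of
`z^α e^{-x²/2 + z²/4}`, because the Hermite function `h_α` is obtained from `φ` by derivatives.

`(2) ⇒ (1)`: Taylor expansion of `e^{⟨t, z⟩}` converges in every Gevrey class `𝓔_s` with `s ≥ 1`
when `(x, ξ)` stays in a compact set, so a compactly supported Gevrey distribution may be applied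
under the integral sign. Hence `f` is a function: `φ` times an entire function of exponential type.
Its Hermite coefficients are the values of the distribution at the functions above, which grow like
`R^{|α|}` times the normalising constant of `h_α`, and that constant is a multiple of
`2^{-|α|/2} α!^{-1/2}`.

`(1) ⇒ (4)`: with `z² = ∑ⱼ zⱼ²` one has
`e^{-i⟨x, ξ⟩ - x²/2 + z²/4} = e^{-|z|²/4} e^{z̄²/8} e^{-z²/8}`. The antianalytic factor `e^{z̄²/8}`
is absorbed into `F₀(z̄)`, so an analytic `G` is needed whose moments
`∫ G(z̄) e^{-|z|²/4} z^α e^{-z²/8} dz` over a polydisc are prescribed numbers of size `R^{|α|}`.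
Multiplication by `z²` acts on the moments as the bounded operator `a ↦ (α ↦ ∑ⱼ a (α + 2eⱼ))`, and
the exponential of an operator is invertible, so the factor `e^{-z²/8}` can be removed. Without it,
the monomials are orthogonal for the rotation invariant weight and the moments are the Taylor
coefficients of `G` up to explicit positive factors, which decay no faster than geometrically.
-/

section DifferentiationUnderIntegral

variable {T : Type*} [MeasurableSpace T] {μ : Measure T}
  {E : Type*} [NormedAddCommGroup E] [NormedSpace ℝ E]
  {F : Type*} [NormedAddCommGroup F] [NormedSpace ℝ F]

theorem hasFTaylorSeriesUpTo_integral_of_dominated {f : T → E → F} (hf : ∀ t, ContDiff ℝ ∞ (f t))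
    (hmeas : ∀ n x, AEStronglyMeasurable (fun t => iteratedFDeriv ℝ n (f t) x) μ)
    (hbound : ∀ n x, ∃ U ∈ nhds x, ∃ b : T → ℝ, Integrable b μ ∧
      ∀ t, ∀ y ∈ U, ‖iteratedFDeriv ℝ n (f t) y‖ ≤ b t) :
    HasFTaylorSeriesUpTo ∞ (fun x => ∫ t, f t x ∂μ)
      (fun x n => ∫ t, iteratedFDeriv ℝ n (f t) x ∂μ) := by
  have integrable_iteratedFDeriv (n : ℕ) (x : E) :
      Integrable (fun t => iteratedFDeriv ℝ n (f t) x) μ := by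
    obtain ⟨U, hU, b, hb, hfb⟩ := hbound n x
    exact hb.mono' (hmeas n x) (.of_forall fun t => hfb t x (mem_of_mem_nhds hU))
  have hasFDerivAt_integral (n : ℕ) (x : E) :
      HasFDerivAt (fun y => ∫ t, iteratedFDeriv ℝ n (f t) y ∂μ)
        (∫ t, iteratedFDeriv ℝ (n + 1) (f t) x ∂μ).curryLeft x := by
    let curry := continuousMultilinearCurryLeftEquiv ℝ (fun _ : Fin (n + 1) => E) F
    obtain ⟨U, hU, b, hb, hfb⟩ := hbound (n + 1) x
    have hcurry : (∫ t, iteratedFDeriv ℝ (n + 1) (f t) x ∂μ).curryLeft =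
        ∫ t, curry (iteratedFDeriv ℝ (n + 1) (f t) x) ∂μ :=
      (ContinuousLinearEquiv.integral_comp_comm (𝕜 := ℝ) (E := E [×(n + 1)]→L[ℝ] F)
        (F := E →L[ℝ] E [×n]→L[ℝ] F) curry.toContinuousLinearEquiv _).symm
    rw [hcurry]
    refine hasFDerivAt_integral_of_dominated_of_fderiv_le
      (F' := fun y t => curry (iteratedFDeriv ℝ (n + 1) (f t) y)) hU
      (.of_forall (hmeas n)) (integrable_iteratedFDeriv n x)
      (curry.continuous.comp_aestronglyMeasurable (hmeas (n + 1) x))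
      (.of_forall fun t y hy => (curry.norm_map _).trans_le (hfb t y hy)) hb
      (.of_forall fun t y _ => ?_)
    have hderiv := ((hf t).differentiable_iteratedFDeriv (m := n)
      (mod_cast ENat.natCast_lt_top n) y).hasFDerivAt
    rwa [fderiv_iteratedFDeriv] at hderiv
  refine ⟨fun x => ?_, fun n _ => hasFDerivAt_integral n, fun n _ =>
    continuous_iff_continuousAt.2 fun x => (hasFDerivAt_integral n x).continuousAt⟩
  exact ((continuousMultilinearCurryFin0 ℝ E F).toContinuousLinearEquiv.integral_comp_comm
    fun t => iteratedFDeriv ℝ 0 (f t) x).symm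

end DifferentiationUnderIntegral

section FactorialBounds

variable {E : Type*} [NormedAddCommGroup E] [NormedSpace ℝ E]

/-- `f` is smooth and `‖D^n f‖ ≤ A a^n n!` on `K` for all `n`, a quantitative form of
real analyticity. The rate `a` is kept apart from the constant `A` because a Gevrey
distribution is continuous for each rate separately. -/
structure FactorialBoundOn (K : Set E) (a A : ℝ) (f : E → ℂ) : Prop where
  contDiff : ContDiff ℝ ∞ f
  const_nonneg : 0 ≤ A
  norm_le : ∀ n : ℕ, ∀ x ∈ K, ‖iteratedFDeriv ℝ n f x‖ ≤ A * a ^ n * (n ! : ℝ)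

namespace FactorialBoundOn

variable {K : Set E} {a b A B : ℝ} {f g : E → ℂ}

theorem mono_set {K' : Set E} (hf : FactorialBoundOn K a A f) (h : K' ⊆ K) :
    FactorialBoundOn K' a A f :=
  ⟨hf.contDiff, hf.const_nonneg, fun n x hx => hf.norm_le n x (h hx)⟩

theorem mono_rate (hf : FactorialBoundOn K a A f) (ha : 0 ≤ a) (h : a ≤ b) :
    FactorialBoundOn K b A f :=
  ⟨hf.contDiff, hf.const_nonneg, fun n x hx => (hf.norm_le n x hx).trans <| by
    have := hf.const_nonneg
    gcongr⟩

theorem gevreyBoundOn {s : ℝ} (hf : FactorialBoundOn K a A f) (ha : 0 ≤ a) (hs : 1 ≤ s) :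
    GevreyBoundOn s K a A f := fun n x hx => by
  have := hf.const_nonneg
  refine (hf.norm_le n x hx).trans ?_
  gcongr
  exact Real.self_le_rpow_of_one_le (mod_cast n.factorial_pos) hs

/-- Separating the rates by a factor `2` makes the sum in Leibniz' rule geometric, so that the
product keeps the larger rate. -/
theorem mul (hf : FactorialBoundOn K a A f) (hg : FactorialBoundOn K b B g) (ha : 0 ≤ a)
    (hab : 2 * a ≤ b) : FactorialBoundOn K b (2 * (A * B)) (fun x => f x * g x) := by
  have hA := hf.const_nonneg
  have hB := hg.const_nonneg
  have hb : 0 ≤ b := by linarith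
  have leibniz_term (n i : ℕ) (hi : i ≤ n) (x : E) (hx : x ∈ K) :
      (n.choose i : ℝ) * ‖iteratedFDeriv ℝ i f x‖ * ‖iteratedFDeriv ℝ (n - i) g x‖ ≤
        A * B * b ^ n * (n ! : ℝ) * (1 / 2) ^ i :=
    calc _ ≤ (n.choose i : ℝ) * (A * (b / 2) ^ i * (i ! : ℝ)) *
          (B * b ^ (n - i) * ((n - i)! : ℝ)) := by
          gcongr
          · refine (hf.norm_le i x hx).trans ?_
            gcongr
            linarith
          · exact hg.norm_le (n - i) x hx
      _ = A * B * (b ^ i * b ^ (n - i)) * ((n.choose i * i ! * (n - i)! : ℕ) : ℝ) *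
          (1 / 2) ^ i := by push_cast; rw [div_eq_mul_one_div b, mul_pow]; ring
      _ = _ := by rw [Nat.choose_mul_factorial_mul_factorial hi, pow_mul_pow_sub b hi]
  refine ⟨hf.contDiff.mul hg.contDiff, by positivity, fun n x hx => ?_⟩
  calc _ ≤ ∑ i ∈ Finset.range (n + 1),
        (n.choose i : ℝ) * ‖iteratedFDeriv ℝ i f x‖ * ‖iteratedFDeriv ℝ (n - i) g x‖ :=
        norm_iteratedFDeriv_mul_le hf.contDiff hg.contDiff x (mod_cast le_top)
    _ ≤ ∑ i ∈ Finset.range (n + 1), A * B * b ^ n * (n ! : ℝ) * (1 / 2) ^ i :=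
        Finset.sum_le_sum fun i hi =>
          leibniz_term n i (Nat.lt_succ_iff.1 (Finset.mem_range.1 hi)) x hx
    _ ≤ A * B * b ^ n * (n ! : ℝ) * 2 := by
        rw [← Finset.mul_sum]
        gcongr
        exact sum_geometric_two_le _
    _ = _ := by ring

theorem integral {T : Type*} [MeasurableSpace T] {μ : Measure T} {f : T → E → ℂ}
    {A : ℝ → T → ℝ} (hA : ∀ R, Integrable (A R) μ)
    (hmeas : ∀ n x, AEStronglyMeasurable (fun t => iteratedFDeriv ℝ n (f t) x) μ)
    (hf : ∀ R t, FactorialBoundOn (Metric.closedBall 0 R) a (A R t) (f t)) (R : ℝ) :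
    FactorialBoundOn (Metric.closedBall 0 R) a (∫ t, A R t ∂μ) (fun x => ∫ t, f t x ∂μ) := by
  have htaylor := hasFTaylorSeriesUpTo_integral_of_dominated (fun t => (hf 0 t).contDiff) hmeas
    fun n x => ⟨Metric.closedBall 0 (‖x‖ + 1),
      Metric.closedBall_mem_nhds_of_mem (by simp), _,
      ((hA _).mul_const (a ^ n)).mul_const (n ! : ℝ), fun t y hy => (hf _ t).norm_le n y hy⟩
  refine ⟨htaylor.contDiff, integral_nonneg fun t => (hf R t).const_nonneg, fun n x hx => ?_⟩
  rw [← htaylor.eq_iteratedFDeriv (mod_cast le_top), ← integral_mul_const, ← integral_mul_const]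
  exact norm_integral_le_of_norm_le (((hA R).mul_const _).mul_const _)
    (.of_forall fun t => (hf R t).norm_le n x hx)

theorem mul_const (hf : FactorialBoundOn K a A f) (c : ℂ) :
    FactorialBoundOn K a (A * ‖c‖) (fun x => f x * c) :=
  ⟨hf.contDiff.mul contDiff_const, mul_nonneg hf.const_nonneg (norm_nonneg c), fun n x hx => by
    have hcf := norm_iteratedFDeriv_smul_of_smooth hf.contDiff c n x
    simp only [Pi.smul_def, smul_eq_mul, mul_comm c] at hcf
    rw [hcf, mul_comm A, mul_assoc, mul_assoc, ← mul_assoc A]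
    gcongr
    exact hf.norm_le n x hx⟩

end FactorialBoundOn

theorem factorialBoundOn_continuousLinearMap {ℓ : E →L[ℝ] ℂ} {R M : ℝ} (hR : 0 ≤ R)
    (hℓ : ‖ℓ‖ ≤ M) : FactorialBoundOn (Metric.closedBall 0 R) 1 ((R + 1) * M) ℓ := by
  have hM : 0 ≤ M := (norm_nonneg ℓ).trans hℓ
  refine ⟨ℓ.contDiff, by positivity, fun n x hx => ?_⟩
  rw [one_pow, mul_one]
  match n with
  | 0 =>
    rw [norm_iteratedFDeriv_zero, Nat.factorial_zero, Nat.cast_one, mul_one, mul_comm]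
    refine (ℓ.le_of_opNorm_le hℓ x).trans ?_
    gcongr
    linarith [mem_closedBall_zero_iff.1 hx]
  | 1 =>
    rw [norm_iteratedFDeriv_one, ℓ.fderiv, Nat.factorial_one, Nat.cast_one, mul_one]
    exact hℓ.trans (le_mul_of_one_le_left hM (by linarith))
  | n + 2 =>
    have hzero : ‖iteratedFDeriv ℝ (n + 2) ℓ x‖ = 0 := by
      rw [← norm_iteratedFDeriv_fderiv, funext fun y => ℓ.fderiv (x := y),
        iteratedFDeriv_succ_const, Pi.zero_apply, norm_zero]
    rw [hzero]
    positivity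

theorem FactorialBoundOn.prod_clm_mul {ι : Type*} (s : Finset ι) {ℓ : ι → E →L[ℝ] ℂ}
    {f : E → ℂ} {R M a A : ℝ} (hR : 0 ≤ R) (hℓ : ∀ i, ‖ℓ i‖ ≤ M) (ha : 2 ≤ a)
    (hf : FactorialBoundOn (Metric.closedBall 0 R) a A f) :
    FactorialBoundOn (Metric.closedBall 0 R) a ((2 * ((R + 1) * M)) ^ s.card * A)
      (fun x => (∏ i ∈ s, ℓ i x) * f x) := by
  classical
  induction s using Finset.induction_on with
  | empty => simpa using hf
  | insert i s hi ih =>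
    have hmul := (factorialBoundOn_continuousLinearMap hR (hℓ i)).mul ih zero_le_one (by linarith)
    simpa only [Finset.prod_insert hi, Finset.card_insert_of_notMem hi, pow_succ', mul_assoc]
      using hmul

theorem IsGevrey.of_factorialBoundOn {f : E → ℂ} {s a : ℝ} (hs : 1 ≤ s) (ha : 0 < a)
    (hf : ∀ R, 0 ≤ R → ∃ A, FactorialBoundOn (Metric.closedBall 0 R) a A f) : IsGevrey s f := by
  obtain ⟨_, hf₀⟩ := hf 0 le_rfl
  refine ⟨hf₀.contDiff, fun K hK => ?_⟩
  obtain ⟨R, hR, hKR⟩ := hK.isBounded.subset_closedBall_lt 0 0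
  obtain ⟨A, hA⟩ := hf R hR.le
  exact ⟨a, A, ha, hA.const_nonneg, (hA.mono_set hKR).gevreyBoundOn ha.le hs⟩

end FactorialBounds

section ExponentialTails

/-- The remainder of order `m` of the Taylor series of the exponential function. -/
noncomputable def expTail (m : ℕ) (w : ℂ) : ℂ :=
  Complex.exp w - ∑ n ∈ Finset.range m, w ^ n / (n ! : ℂ)

theorem expTail_zero : expTail 0 = Complex.exp := by
  ext w
  simp [expTail]

theorem contDiff_expTail {𝕜 : Type*} [NontriviallyNormedField 𝕜] [NormedAlgebra 𝕜 ℂ] {k : ℕ∞ω}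
    (m : ℕ) : ContDiff 𝕜 k (expTail m) := by
  unfold expTail
  fun_prop

theorem hasDerivAt_expTail (m : ℕ) (w : ℂ) : HasDerivAt (expTail m) (expTail (m - 1) w) w := by
  rcases m with _ | m
  · simpa [expTail_zero] using Complex.hasDerivAt_exp w
  have hterm (n : ℕ) : HasDerivAt (fun w : ℂ => w ^ n / (n ! : ℂ))
      ((n : ℂ) * w ^ (n - 1) / (n ! : ℂ)) w := (hasDerivAt_pow n w).div_const _
  refine (Complex.hasDerivAt_exp w).sub <|
    (HasDerivAt.fun_sum fun n (_ : n ∈ Finset.range (m + 1)) => hterm n).congr_deriv ?_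
  rw [Finset.sum_range_succ', Nat.add_sub_cancel]
  simp only [Nat.cast_zero, zero_mul, zero_div, add_zero, Nat.add_sub_cancel]
  refine Finset.sum_congr rfl fun n _ => ?_
  rw [Nat.factorial_succ, Nat.cast_mul, mul_div_mul_left _ _ (mod_cast n.succ_ne_zero)]

theorem iteratedDeriv_expTail (n m : ℕ) : iteratedDeriv n (expTail m) = expTail (m - n) := by
  induction n with
  | zero => rw [iteratedDeriv_zero, Nat.sub_zero]
  | succ n ih =>
    rw [iteratedDeriv_succ, ih, funext fun w => (hasDerivAt_expTail (m - n) w).deriv, Nat.sub_sub]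

theorem norm_expTail_le (m : ℕ) (w : ℂ) :
    ‖expTail m w‖ ≤ (1 / 2) ^ m * Real.exp (2 * ‖w‖) := by
  have hasSum_exp (x : ℝ) : HasSum (fun n : ℕ => x ^ n / (n ! : ℝ)) (Real.exp x) := by
    rw [Real.exp_eq_exp_ℝ]
    exact NormedSpace.expSeries_div_hasSum_exp x
  have htail := (hasSum_nat_add_iff' m).2 (hasSum_exp ‖w‖)
  have htail_two := ((hasSum_nat_add_iff' m).2 (hasSum_exp (2 * ‖w‖))).mul_left ((1 / 2 : ℝ) ^ m)
  calc ‖expTail m w‖ ≤ Real.exp ‖w‖ - ∑ n ∈ Finset.range m, ‖w‖ ^ n / (n ! : ℝ) :=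
        Complex.norm_exp_sub_sum_le_exp_norm_sub_sum w m
    _ ≤ (1 / 2) ^ m *
        (Real.exp (2 * ‖w‖) - ∑ n ∈ Finset.range m, (2 * ‖w‖) ^ n / (n ! : ℝ)) := by
        refine hasSum_le (fun n => ?_) htail htail_two
        rw [← mul_div_assoc, mul_pow, ← mul_assoc, pow_add 2, mul_left_comm, ← mul_pow,
          one_div_mul_cancel two_ne_zero, one_pow, mul_one]
        gcongr
        exact le_mul_of_one_le_left (by positivity) (one_le_pow₀ one_le_two)
    _ ≤ _ := by
        gcongr
        exact sub_le_self _ (Finset.sum_nonneg fun _ _ => by positivity)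

variable {E : Type*} [NormedAddCommGroup E] [NormedSpace ℝ E]

theorem norm_iteratedFDeriv_expTail_comp_le (m n : ℕ) (ℓ : E →L[ℝ] ℂ) (p : E) :
    ‖iteratedFDeriv ℝ n (fun q => expTail m (ℓ q)) p‖ ≤ ‖expTail (m - n) (ℓ p)‖ * ‖ℓ‖ ^ n := by
  have hreal : ‖iteratedFDeriv ℝ n (expTail m) (ℓ p)‖ = ‖expTail (m - n) (ℓ p)‖ := by
    rw [← (contDiff_expTail m).contDiffAt.restrictScalars_iteratedFDeriv (𝕜 := ℝ) (𝕜' := ℂ),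
      Function.comp_apply, ContinuousMultilinearMap.norm_restrictScalars,
      norm_iteratedFDeriv_eq_norm_iteratedDeriv, iteratedDeriv_expTail]
  rw [← hreal]
  have hcomp := ℓ.iteratedFDeriv_comp_right (contDiff_expTail (k := n) m) p le_rfl
  rw [Function.comp_def] at hcomp
  rw [hcomp]
  refine (ContinuousMultilinearMap.norm_compContinuousLinearMap_le _ _).trans_eq ?_
  rw [Finset.prod_const, Finset.card_univ, Fintype.card_fin]

theorem factorialBoundOn_expTail_comp (m : ℕ) (ℓ : E →L[ℝ] ℂ) (R : ℝ) :
    FactorialBoundOn (Metric.closedBall 0 R) 2 ((1 / 2) ^ m * Real.exp ((2 * R + 1) * ‖ℓ‖))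
      (fun p => expTail m (ℓ p)) := by
  refine ⟨(contDiff_expTail m).comp ℓ.contDiff, by positivity, fun n p hp => ?_⟩
  have hℓp : ‖ℓ p‖ ≤ ‖ℓ‖ * R := ℓ.le_opNorm_of_le (mem_closedBall_zero_iff.1 hp)
  have hpow : ‖ℓ‖ ^ n ≤ Real.exp ‖ℓ‖ * (n ! : ℝ) :=
    (div_le_iff₀ (by positivity)).1 (Real.pow_div_factorial_le_exp _ (norm_nonneg ℓ) n)
  have hhalf : (1 / 2 : ℝ) ^ (m - n) ≤ (1 / 2) ^ m * 2 ^ n := by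
    rw [← div_le_iff₀ (by positivity), div_eq_mul_inv, ← inv_pow, ← one_div, ← pow_add]
    exact pow_le_pow_of_le_one (by norm_num) (by norm_num) (by lia)
  calc _ ≤ ‖expTail (m - n) (ℓ p)‖ * ‖ℓ‖ ^ n := norm_iteratedFDeriv_expTail_comp_le m n ℓ p
    _ ≤ (1 / 2) ^ (m - n) * Real.exp (2 * ‖ℓ p‖) * (Real.exp ‖ℓ‖ * (n ! : ℝ)) := by
        gcongr
        exact norm_expTail_le _ _
    _ ≤ (1 / 2) ^ m * 2 ^ n * Real.exp (2 * (‖ℓ‖ * R)) * (Real.exp ‖ℓ‖ * (n ! : ℝ)) := by gcongr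
    _ = _ := by rw [add_mul, one_mul, Real.exp_add, mul_right_comm 2, mul_assoc 2]; ring

theorem continuous_iteratedFDeriv_comp_clm {F G : Type*} [NormedAddCommGroup F] [NormedSpace ℝ F]
    [NormedAddCommGroup G] [NormedSpace ℝ G] {n : ℕ} {f : F → G} (hf : ContDiff ℝ n f) (x : E) :
    Continuous fun ℓ : E →L[ℝ] F => iteratedFDeriv ℝ n (fun y => f (ℓ y)) x := by
  have hcomp (ℓ : E →L[ℝ] F) : iteratedFDeriv ℝ n (fun y => f (ℓ y)) x =
      ContinuousMultilinearMap.compContinuousLinearMapContinuousMultilinear ℝ (fun _ : Fin n => E)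
        (fun _ => F) G (fun _ => ℓ) (iteratedFDeriv ℝ n f (ℓ x)) :=
    ℓ.iteratedFDeriv_comp_right hf x le_rfl
  rw [funext hcomp]
  have := hf.continuous_iteratedFDeriv le_rfl
  fun_prop

end ExponentialTails

section ExpIntegrable

theorem exists_norm_polynomial_eval_le_exp {𝕜 : Type*} [NormedField 𝕜] (q : Polynomial 𝕜) :
    ∃ C : ℝ, 0 ≤ C ∧ ∀ z : 𝕜, ‖q.eval z‖ ≤ C * Real.exp ‖z‖ := by
  induction q using Polynomial.induction_on' with
  | add p q hp hq =>
    obtain ⟨C, hC, hp⟩ := hp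
    obtain ⟨D, hD, hq⟩ := hq
    refine ⟨C + D, by positivity, fun z => ?_⟩
    rw [Polynomial.eval_add, add_mul]
    exact norm_add_le_of_le (hp z) (hq z)
  | monomial n a =>
    refine ⟨‖a‖ * (n ! : ℝ), by positivity, fun z => ?_⟩
    rw [Polynomial.eval_monomial, norm_mul, norm_pow, mul_assoc, mul_comm (n ! : ℝ)]
    gcongr
    exact (div_le_iff₀ (by positivity)).1 (Real.pow_div_factorial_le_exp ‖z‖ (norm_nonneg _) n)

variable {X : Type*} [NormedAddCommGroup X] [MeasurableSpace X] {μ : Measure X}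

/-- `c` is measurable and integrable against every exponential `e^{R‖t‖}`. -/
structure ExpIntegrable (c : X → ℂ) (μ : Measure X) : Prop where
  aestronglyMeasurable : AEStronglyMeasurable c μ
  integrable : ∀ R : ℝ, Integrable (fun t => Real.exp (R * ‖t‖) * ‖c t‖) μ

namespace ExpIntegrable

variable {c : X → ℂ}

theorem integrable_self (hc : ExpIntegrable c μ) : Integrable c μ := by
  have := hc.integrable 0
  simp only [zero_mul, Real.exp_zero, one_mul] at this
  exact (integrable_norm_iff hc.aestronglyMeasurable).1 this

theorem hasSum_integral_mul {p : ℕ → X → ℂ} {D S : ℝ} (hc : ExpIntegrable c μ)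
    (hp : ∀ n, AEStronglyMeasurable (p n) μ)
    (hle : ∀ n t, ‖p n t‖ ≤ D * ((S * ‖t‖) ^ n / (n ! : ℝ))) :
    HasSum (fun n => ∫ t, p n t * c t ∂μ) (∫ t, (∑' n, p n t) * c t ∂μ) := by
  have hexp (t : X) : HasSum (fun n : ℕ => D * ((S * ‖t‖) ^ n / (n ! : ℝ)) * ‖c t‖)
      (D * Real.exp (S * ‖t‖) * ‖c t‖) := by
    rw [Real.exp_eq_exp_ℝ]
    exact ((NormedSpace.expSeries_div_hasSum_exp (S * ‖t‖)).mul_left D).mul_right ‖c t‖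
  refine hasSum_integral_of_dominated_convergence
    (fun n t => D * ((S * ‖t‖) ^ n / (n ! : ℝ)) * ‖c t‖)
    (fun n => (hp n).mul hc.aestronglyMeasurable)
    (fun n => .of_forall fun t => ?_) (.of_forall fun t => (hexp t).summable) ?_
    (.of_forall fun t => ?_)
  · rw [norm_mul]
    gcongr
    exact hle n t
  · simp_rw [fun t => (hexp t).tsum_eq, mul_assoc]
    exact (hc.integrable S).const_mul D
  · refine HasSum.mul_right _ (Summable.hasSum (.of_norm_bounded ?_ fun n => hle n t))
    exact (Real.summable_pow_div_factorial (S * ‖t‖)).mul_left D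

variable [OpensMeasurableSpace X]

theorem of_norm_le {b : X → ℂ} (hb : ExpIntegrable b μ) (hc : AEStronglyMeasurable c μ) {C R : ℝ}
    (h : ∀ t, ‖c t‖ ≤ C * (Real.exp (R * ‖t‖) * ‖b t‖)) : ExpIntegrable c μ := by
  refine ⟨hc, fun S => ((hb.integrable (S + R)).const_mul C).mono'
    ((by fun_prop : Continuous fun t : X => Real.exp (S * ‖t‖)).aestronglyMeasurable.mul hc.norm)
    (.of_forall fun t => ?_)⟩
  rw [Real.norm_of_nonneg (by positivity), add_mul, Real.exp_add]
  calc _ ≤ Real.exp (S * ‖t‖) * (C * (Real.exp (R * ‖t‖) * ‖b t‖)) := by gcongr; exact h t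
    _ = _ := by ring

theorem bounded_mul (hc : ExpIntegrable c μ) {g : X → ℂ} (hg : AEStronglyMeasurable g μ) {C : ℝ}
    (hC : ∀ t, ‖g t‖ ≤ C) : ExpIntegrable (fun t => g t * c t) μ :=
  hc.of_norm_le (hg.mul hc.aestronglyMeasurable) (C := C) (R := 0) fun t => by
    rw [norm_mul, zero_mul, Real.exp_zero, one_mul]
    gcongr
    exact hC t

theorem const_mul (hc : ExpIntegrable c μ) (a : ℂ) : ExpIntegrable (fun t => a * c t) μ :=
  hc.bounded_mul aestronglyMeasurable_const fun _ => le_rfl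

variable [NormedSpace ℝ X]

theorem eval_clm_mul (hc : ExpIntegrable c μ) (q : Polynomial ℂ) (ℓ : X →L[ℝ] ℂ) :
    ExpIntegrable (fun t => q.eval (ℓ t) * c t) μ := by
  obtain ⟨C, hC, hle⟩ := exists_norm_polynomial_eval_le_exp q
  have hcont : Continuous fun t => q.eval (ℓ t) := by fun_prop
  refine hc.of_norm_le (hcont.aestronglyMeasurable.mul hc.aestronglyMeasurable) (C := C)
    (R := ‖ℓ‖) fun t => ?_
  rw [norm_mul, ← mul_assoc]
  gcongr
  exact (hle _).trans (by gcongr; exact ℓ.le_opNorm t)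

theorem prod_eval_clm_mul (hc : ExpIntegrable c μ) {ι : Type*} (s : Finset ι)
    (q : ι → Polynomial ℂ) (ℓ : ι → X →L[ℝ] ℂ) :
    ExpIntegrable (fun t => (∏ i ∈ s, (q i).eval (ℓ i t)) * c t) μ := by
  classical
  induction s using Finset.induction_on with
  | empty => simpa using hc
  | insert i s hi ih =>
    simpa only [Finset.prod_insert hi, mul_assoc] using ih.eval_clm_mul (q i) (ℓ i)

variable {V : Type*} [NormedAddCommGroup V] [NormedSpace ℝ V]

theorem integrable_exp_opNorm (hc : ExpIntegrable c μ) (L : X →L[ℝ] V →L[ℝ] ℂ) (R : ℝ) :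
    Integrable (fun t => Real.exp (R * ‖L t‖) * ‖c t‖) μ := by
  refine (hc.integrable (|R| * ‖L‖)).mono'
    ((by fun_prop : Continuous fun t => Real.exp (R * ‖L t‖)).aestronglyMeasurable.mul
      hc.aestronglyMeasurable.norm) (.of_forall fun t => ?_)
  rw [Real.norm_of_nonneg (by positivity), mul_assoc |R|]
  gcongr
  · exact le_abs_self R
  · exact L.le_opNorm t

theorem integrable_cexp_mul (hc : ExpIntegrable c μ) (L : X →L[ℝ] V →L[ℝ] ℂ) (p : V) :
    Integrable (fun t => Complex.exp (L t p) * c t) μ := by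
  refine (hc.integrable_exp_opNorm L ‖p‖).mono'
    ((by fun_prop : Continuous fun t => Complex.exp (L t p)).aestronglyMeasurable.mul
      hc.aestronglyMeasurable) (.of_forall fun t => ?_)
  rw [norm_mul]
  gcongr
  refine (Complex.norm_exp_le_exp_norm _).trans ?_
  rw [mul_comm, Real.exp_le_exp]
  exact (L t).le_opNorm p

theorem factorialBoundOn_integral_expTail [SecondCountableTopology X] (hc : ExpIntegrable c μ)
    (L : X →L[ℝ] V →L[ℝ] ℂ) (m : ℕ) (R : ℝ) :
    FactorialBoundOn (Metric.closedBall 0 R) 2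
      ((1 / 2) ^ m * ∫ t, Real.exp ((2 * R + 1) * ‖L t‖) * ‖c t‖ ∂μ)
      (fun p => ∫ t, expTail m (L t p) * c t ∂μ) := by
  rw [← integral_const_mul]
  refine FactorialBoundOn.integral (A := fun R t =>
      (1 / 2) ^ m * (Real.exp ((2 * R + 1) * ‖L t‖) * ‖c t‖))
    (fun R => (hc.integrable_exp_opNorm L _).const_mul _) (fun n p => ?_) (fun R t => ?_) R
  · have hsmul (t : X) : iteratedFDeriv ℝ n (fun q => expTail m (L t q) * c t) p =
        c t • iteratedFDeriv ℝ n (fun q => expTail m (L t q)) p := by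
      simp_rw [mul_comm _ (c t)]
      exact iteratedFDeriv_const_smul_apply' (a := c t)
        ((contDiff_expTail m).comp (L t).contDiff).contDiffAt
    simp_rw [hsmul]
    exact hc.aestronglyMeasurable.smul ((continuous_iteratedFDeriv_comp_clm
      (contDiff_expTail m) p).comp L.continuous).aestronglyMeasurable
  · simpa only [mul_assoc] using (factorialBoundOn_expTail_comp m (L t) R).mul_const (c t)

theorem factorialBoundOn_integral_cexp [SecondCountableTopology X] (hc : ExpIntegrable c μ)
    (L : X →L[ℝ] V →L[ℝ] ℂ) (R : ℝ) :
    FactorialBoundOn (Metric.closedBall 0 R) 2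
      (∫ t, Real.exp ((2 * R + 1) * ‖L t‖) * ‖c t‖ ∂μ)
      (fun p => ∫ t, Complex.exp (L t p) * c t ∂μ) := by
  simpa only [expTail_zero, pow_zero, one_mul] using hc.factorialBoundOn_integral_expTail L 0 R

end ExpIntegrable

end ExpIntegrable

section Gaussian

variable {V : Type*} [NormedAddCommGroup V] [InnerProductSpace ℝ V]
  {E : Type*} [NormedAddCommGroup E] [NormedSpace ℝ E]

/-- The bilinear form `(t, p) ↦ a ⟨t, A p⟩`. -/
noncomputable def innerForm (a : ℂ) (A : E →L[ℝ] V) : V →L[ℝ] E →L[ℝ] ℂ :=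
  (ContinuousLinearMap.postcomp E (a • Complex.ofRealCLM)).comp
    ((ContinuousLinearMap.precomp ℝ A).comp (innerSL ℝ))

theorem innerForm_apply (a : ℂ) (A : E →L[ℝ] V) (t : V) (p : E) :
    innerForm a A t p = a * (inner ℝ t (A p) : ℝ) := rfl

variable [FiniteDimensional ℝ V] [MeasurableSpace V] [BorelSpace V]

theorem expIntegrable_gaussian {b : ℝ} (hb : 0 < b) :
    ExpIntegrable (fun t : V => ((Real.exp (-b * ‖t‖ ^ 2) : ℝ) : ℂ)) volume := by
  refine ⟨(by fun_prop : Continuous _).aestronglyMeasurable, fun R => ?_⟩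
  have hint : Integrable fun t : V => Real.exp (-(b / 2) * ‖t‖ ^ 2) := by
    simpa [Complex.norm_exp, ← Complex.ofReal_pow] using
      (GaussianFourier.integrable_cexp_neg_mul_sq_norm_add (V := V) (b := (b / 2 : ℝ))
        (by rw [Complex.ofReal_re]; positivity) 0 0).norm
  refine (hint.const_mul (Real.exp (R ^ 2 / (2 * b)))).mono'
    (by fun_prop : Continuous _).aestronglyMeasurable (.of_forall fun t => ?_)
  rw [Complex.norm_real, norm_mul, norm_norm, Real.norm_of_nonneg (Real.exp_pos _).le,
    Real.norm_of_nonneg (Real.exp_pos _).le, ← Real.exp_add, ← Real.exp_add, Real.exp_le_exp,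
    ← sub_nonneg]
  calc 0 ≤ (R - b * ‖t‖) ^ 2 / (2 * b) := by positivity
    _ = _ := by field_simp; ring

theorem integral_cexp_I_inner_mul_gaussian (w : V) :
    ∫ t : V, Complex.exp (Complex.I * (inner ℝ t w : ℝ)) *
        (((2 * Real.pi : ℂ) ^ (Module.finrank ℝ V / 2 : ℂ))⁻¹ *
          ((Real.exp (-(1 / 2) * ‖t‖ ^ 2) : ℝ) : ℂ)) =
      ((Real.exp (-‖w‖ ^ 2 / 2) : ℝ) : ℂ) := by
  have hgauss := GaussianFourier.integral_cexp_neg_mul_sq_norm_add (V := V) (b := 1 / 2)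
    (by norm_num) Complex.I w
  have hconst : (2 * Real.pi : ℂ) ^ (Module.finrank ℝ V / 2 : ℂ) ≠ 0 := by
    rw [Ne, Complex.cpow_eq_zero_iff]
    simp [Real.pi_ne_zero]
  calc _ = ((2 * Real.pi : ℂ) ^ (Module.finrank ℝ V / 2 : ℂ))⁻¹ * ∫ t : V,
        Complex.exp (-(1 / 2) * (‖t‖ : ℂ) ^ 2 + Complex.I * (inner ℝ w t : ℝ)) := by
        rw [← integral_const_mul]
        congr 1 with t
        rw [Complex.exp_add, real_inner_comm]
        push_cast
        ring
    _ = _ := by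
        rw [hgauss, div_div_eq_mul_div, div_one, mul_comm (Real.pi : ℂ),
          inv_mul_cancel_left₀ hconst, Complex.I_sq]
        push_cast
        ring_nf

/-- The Gaussian is its own Fourier transform, hence an exponential integral. -/
theorem exists_factorialBoundOn_gaussian_comp (A : E →L[ℝ] V) (R : ℝ) :
    ∃ C, FactorialBoundOn (Metric.closedBall 0 R) 2 C
      (fun p => ((Real.exp (-‖A p‖ ^ 2 / 2) : ℝ) : ℂ)) := by
  have hc := (expIntegrable_gaussian (V := V) one_half_pos).const_mul
    ((2 * Real.pi : ℂ) ^ (Module.finrank ℝ V / 2 : ℂ))⁻¹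
  have hF := hc.factorialBoundOn_integral_cexp (innerForm Complex.I A) R
  simp only [innerForm_apply, integral_cexp_I_inner_mul_gaussian] at hF
  exact ⟨_, hF⟩

end Gaussian

noncomputable section

section LaplaceTransform

variable {d : ℕ}

/-- The complex coordinate `z_j = x_j + i ξ_j` on phase space. -/
def zCoord (j : Fin d) : (RSp d × RSp d) →L[ℝ] ℂ :=
  Complex.ofRealCLM.comp ((EuclideanSpace.proj j).comp (.fst ℝ (RSp d) (RSp d))) +
    Complex.I • Complex.ofRealCLM.comp ((EuclideanSpace.proj j).comp (.snd ℝ (RSp d) (RSp d)))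

theorem zCoord_apply (j : Fin d) (p : RSp d × RSp d) :
    zCoord j p = (p.1 j : ℂ) + Complex.I * (p.2 j : ℂ) := rfl

theorem norm_zCoord_le (j : Fin d) : ‖(zCoord j : (RSp d × RSp d) →L[ℝ] ℂ)‖ ≤ 2 := by
  refine ContinuousLinearMap.opNorm_le_bound _ zero_le_two fun p => ?_
  rw [zCoord_apply, two_mul]
  refine norm_add_le_of_le ?_ ?_
  · rw [Complex.norm_real]
    exact (PiLp.norm_apply_le p.1 j).trans (norm_fst_le p)
  · rw [norm_mul, Complex.norm_I, one_mul, Complex.norm_real]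
    exact (PiLp.norm_apply_le p.2 j).trans (norm_snd_le p)

/-- The bilinear form `t · z = ∑ j, t_j z_j`, `z = x + iξ`. -/
def dualForm : RSp d →L[ℝ] (RSp d × RSp d) →L[ℝ] ℂ :=
  innerForm 1 (ContinuousLinearMap.fst ℝ _ _) +
    innerForm Complex.I (ContinuousLinearMap.snd ℝ _ _)

theorem dualForm_eq_inner (t : RSp d) (p : RSp d × RSp d) :
    dualForm t p = (inner ℝ t p.1 : ℝ) + Complex.I * (inner ℝ t p.2 : ℝ) := by
  simp [dualForm, innerForm_apply]

theorem dualForm_eq_sum (t : RSp d) (p : RSp d × RSp d) :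
    dualForm t p = ∑ j, (t j : ℂ) * zCoord j p := by
  simp only [dualForm_eq_inner, zCoord_apply, PiLp.inner_apply, RCLike.inner_apply, conj_trivial]
  push_cast
  rw [Finset.mul_sum, ← Finset.sum_add_distrib]
  exact Finset.sum_congr rfl fun j _ => by ring

/-- The Gaussian `e^{-|x|²/2}` as a function of `(x, ξ)`. -/
def positionGaussian (p : RSp d × RSp d) : ℂ := ((Real.exp (-‖p.1‖ ^ 2 / 2) : ℝ) : ℂ)

theorem exists_factorialBoundOn_positionGaussian (R : ℝ) :
    ∃ A, FactorialBoundOn (Metric.closedBall 0 R) 2 A (positionGaussian (d := d)) :=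
  exists_factorialBoundOn_gaussian_comp (ContinuousLinearMap.fst ℝ (RSp d) (RSp d)) R

/-- `p ↦ e^{-|x|²/2} ∫ e^{t·z} c(t) dt`: for `c = conj g · φ` it is the conjugate of `V_φ g`. -/
def laplaceTransform (c : RSp d → ℂ) (p : RSp d × RSp d) : ℂ :=
  positionGaussian p * ∫ t, Complex.exp (dualForm t p) * c t

theorem ExpIntegrable.exists_factorialBoundOn_laplaceTransform {c : RSp d → ℂ}
    (hc : ExpIntegrable c volume) (R : ℝ) :
    ∃ A, FactorialBoundOn (Metric.closedBall 0 R) 4 A (laplaceTransform c) := by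
  obtain ⟨A, hA⟩ := exists_factorialBoundOn_positionGaussian (d := d) R
  exact ⟨_, hA.mul ((hc.factorialBoundOn_integral_cexp dualForm R).mono_rate zero_le_two
    (by norm_num)) zero_le_two (by norm_num)⟩

theorem gaussianWindow_sub (t x : RSp d) :
    gaussianWindow d (t - x) = gaussianWindow d t *
      ((Real.exp (inner ℝ t x) * Real.exp (-‖x‖ ^ 2 / 2) : ℝ) : ℂ) := by
  unfold gaussianWindow
  rw [← Complex.ofReal_mul, mul_assoc, ← Real.exp_add, ← Real.exp_add, norm_sub_sq_real]
  ring_nf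

theorem conj_stft_gaussianWindow (g : RSp d → ℂ) (p : RSp d × RSp d) :
    conj (stft (gaussianWindow d) g p) =
      laplaceTransform (fun t => conj (g t) * gaussianWindow d t) p := by
  unfold stft laplaceTransform
  rw [← integral_conj, ← integral_const_mul]
  congr 1 with t
  rw [gaussianWindow_sub, dualForm_eq_inner, Complex.exp_add, positionGaussian]
  simp only [map_mul, ← Complex.exp_conj, map_neg, Complex.conj_I, Complex.conj_ofReal, neg_neg,
    Complex.conj_conj]
  push_cast
  ring

theorem expIntegrable_gaussianWindow (d : ℕ) : ExpIntegrable (gaussianWindow d) volume := by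
  have hwindow : gaussianWindow d = fun t => ((Real.pi ^ (-(d : ℝ) / 4) : ℝ) : ℂ) *
      ((Real.exp (-(1 / 2) * ‖t‖ ^ 2) : ℝ) : ℂ) := by
    ext t
    rw [gaussianWindow, ← Complex.ofReal_mul]
    ring_nf
  rw [hwindow]
  exact (expIntegrable_gaussian one_half_pos).const_mul _

end LaplaceTransform

section Duality

variable {d : ℕ} {s : ℝ}

theorem continuous_prod_coord {n : ℕ} (k : Fin n → Fin d) :
    Continuous fun t : RSp d => ∏ i, (t (k i) : ℂ) := by
  fun_prop

theorem sum_prod_norm_coord_le (n : ℕ) (t : RSp d) :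
    ∑ k : Fin n → Fin d, ∏ i, ‖(t (k i) : ℂ)‖ ≤ (d * ‖t‖) ^ n := by
  rw [← Fintype.sum_pow (fun j => ‖(t j : ℂ)‖) n]
  gcongr
  calc ∑ j, ‖(t j : ℂ)‖ ≤ ∑ _j : Fin d, ‖t‖ := Finset.sum_le_sum fun j _ => by
        rw [Complex.norm_real]
        exact PiLp.norm_apply_le t j
    _ = _ := by simp

theorem ExpIntegrable.prod_coord_mul {c : RSp d → ℂ} (hc : ExpIntegrable c volume) {n : ℕ}
    (k : Fin n → Fin d) : ExpIntegrable (fun t => (∏ i, (t (k i) : ℂ)) * c t) volume := by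
  simpa using hc.prod_eval_clm_mul Finset.univ (fun _ => Polynomial.X)
    fun i => Complex.ofRealCLM.comp (EuclideanSpace.proj (k i))

/-- The Gevrey function `z_{k_1} ⋯ z_{k_n} e^{-|x|²/2}` of a word `k` in the coordinates. -/
def wordFun (hs : 1 ≤ s) {n : ℕ} (k : Fin n → Fin d) : gevreySpace s (RSp d × RSp d) :=
  ⟨fun p => (∏ i, zCoord (k i) p) * positionGaussian p,
    .of_factorialBoundOn hs two_pos fun R hR => by
      obtain ⟨A, hA⟩ := exists_factorialBoundOn_positionGaussian (d := d) R
      exact ⟨_, hA.prod_clm_mul _ hR (fun i => norm_zCoord_le (k i)) le_rfl⟩⟩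

/-- `laplaceTransform c` as a Gevrey function. -/
def laplaceFun (hs : 1 ≤ s) {c : RSp d → ℂ} (hc : ExpIntegrable c volume) :
    gevreySpace s (RSp d × RSp d) :=
  ⟨laplaceTransform c,
    .of_factorialBoundOn hs four_pos fun R _ => hc.exists_factorialBoundOn_laplaceTransform R⟩

/-- The terms of the expansion of `F(e^{t·z} e^{-|x|²/2})` in powers of `t`. -/
def dualTerm (hs : 1 ≤ s) (F : Module.Dual ℂ (gevreySpace s (RSp d × RSp d))) (n : ℕ)
    (t : RSp d) : ℂ :=
  ∑ k : Fin n → Fin d, (∏ i, (t (k i) : ℂ)) * (F (wordFun hs k) / (n ! : ℂ))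

theorem continuous_dualTerm (hs : 1 ≤ s) (F : Module.Dual ℂ (gevreySpace s (RSp d × RSp d)))
    (n : ℕ) : Continuous (dualTerm hs F n) :=
  continuous_finsetSum _ fun k _ => (continuous_prod_coord k).mul continuous_const

theorem integral_sum_prod_coord_mul {c : RSp d → ℂ} (hc : ExpIntegrable c volume) {n : ℕ}
    (w : (Fin n → Fin d) → ℂ) :
    ∫ t, (∑ k : Fin n → Fin d, (∏ i, (t (k i) : ℂ)) * w k) * c t =
      ∑ k : Fin n → Fin d, (∫ t, (∏ i, (t (k i) : ℂ)) * c t) * w k := by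
  simp_rw [Finset.sum_mul, mul_right_comm]
  rw [integral_finsetSum _ fun k _ => (hc.prod_coord_mul k).integrable_self.mul_const _]
  simp_rw [integral_mul_const]

theorem dualForm_pow_div_factorial (t : RSp d) (p : RSp d × RSp d) (n : ℕ) :
    dualForm t p ^ n / (n ! : ℂ) =
      ∑ k : Fin n → Fin d, (∏ i, (t (k i) : ℂ)) * ((∏ i, zCoord (k i) p) / (n ! : ℂ)) := by
  rw [dualForm_eq_sum, Fintype.sum_pow, Finset.sum_div]
  simp_rw [Finset.prod_mul_distrib, mul_div_assoc]

theorem integrable_dualForm_pow_mul {c : RSp d → ℂ} (hc : ExpIntegrable c volume)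
    (p : RSp d × RSp d) (n : ℕ) : Integrable fun t => dualForm t p ^ n / (n ! : ℂ) * c t := by
  simp_rw [dualForm_pow_div_factorial, Finset.sum_mul, mul_right_comm]
  exact integrable_finsetSum _ fun k _ => (hc.prod_coord_mul k).integrable_self.mul_const _

theorem laplaceTransform_eq_sum_add {c : RSp d → ℂ} (hc : ExpIntegrable c volume) (N : ℕ)
    (p : RSp d × RSp d) :
    laplaceTransform c p =
      (∑ n ∈ Finset.range N, ∑ k : Fin n → Fin d,
        ((∫ t, (∏ i, (t (k i) : ℂ)) * c t) / (n ! : ℂ)) *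
          ((∏ i, zCoord (k i) p) * positionGaussian p)) +
      positionGaussian p * ∫ t, expTail N (dualForm t p) * c t := by
  have hint := integrable_dualForm_pow_mul hc p
  have htail : ∫ t, expTail N (dualForm t p) * c t = (∫ t, Complex.exp (dualForm t p) * c t) -
      ∑ n ∈ Finset.range N, ∫ t, dualForm t p ^ n / (n ! : ℂ) * c t := by
    rw [← integral_finsetSum _ fun n _ => hint n, ← integral_sub
      (hc.integrable_cexp_mul dualForm p) (integrable_finsetSum _ fun n _ => hint n)]
    simp_rw [expTail, sub_mul, Finset.sum_mul]
  rw [htail, laplaceTransform, mul_sub, ← sub_eq_iff_eq_add, sub_sub_cancel, Finset.mul_sum]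
  refine Finset.sum_congr rfl fun n _ => ?_
  simp_rw [dualForm_pow_div_factorial]
  rw [integral_sum_prod_coord_mul hc, Finset.mul_sum]
  exact Finset.sum_congr rfl fun k _ => by ring

theorem exists_norm_apply_le_of_mem_gevreyDual (hs : 1 ≤ s)
    {F : Module.Dual ℂ (gevreySpace s (RSp d × RSp d))} (hF : F ∈ gevreyDual s (RSp d × RSp d))
    {a : ℝ} (ha : 0 < a) :
    ∃ C R : ℝ, 0 ≤ C ∧ 0 ≤ R ∧ ∀ (G : gevreySpace s (RSp d × RSp d)) {A : ℝ},
      FactorialBoundOn (Metric.closedBall 0 R) a A (G : RSp d × RSp d → ℂ) → ‖F G‖ ≤ C * A := by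
  obtain ⟨K, hK, hFK⟩ := hF
  obtain ⟨C, hC⟩ := hFK a ha
  obtain ⟨R, hR, hKR⟩ := hK.isBounded.subset_closedBall_lt 0 0
  refine ⟨|C|, R, abs_nonneg C, hR.le, fun G {A} hG => ?_⟩
  have hA := hG.const_nonneg
  calc ‖F G‖ ≤ C * A := hC G A hA ((hG.mono_set hKR).gevreyBoundOn ha.le hs)
    _ ≤ |C| * A := by gcongr; exact le_abs_self C

theorem exists_norm_apply_wordFun_le (hs : 1 ≤ s)
    {F : Module.Dual ℂ (gevreySpace s (RSp d × RSp d))} (hF : F ∈ gevreyDual s (RSp d × RSp d)) :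
    ∃ D R : ℝ, 0 ≤ D ∧ 0 ≤ R ∧ ∀ {n : ℕ} (k : Fin n → Fin d), ‖F (wordFun hs k)‖ ≤ D * R ^ n := by
  obtain ⟨C, R, hC, hR, hFC⟩ := exists_norm_apply_le_of_mem_gevreyDual hs hF two_pos
  obtain ⟨A, hA⟩ := exists_factorialBoundOn_positionGaussian (d := d) R
  have hA₀ := hA.const_nonneg
  refine ⟨C * A, 2 * ((R + 1) * 2), by positivity, by positivity, fun {n} k => ?_⟩
  refine (hFC _ (hA.prod_clm_mul Finset.univ hR (fun i => norm_zCoord_le (k i)) le_rfl)).trans_eq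
    ?_
  rw [Finset.card_univ, Fintype.card_fin]
  ring

theorem exists_norm_dualTerm_le (hs : 1 ≤ s)
    {F : Module.Dual ℂ (gevreySpace s (RSp d × RSp d))} (hF : F ∈ gevreyDual s (RSp d × RSp d)) :
    ∃ D S : ℝ, ∀ n t, ‖dualTerm hs F n t‖ ≤ D * ((S * ‖t‖) ^ n / (n ! : ℝ)) := by
  obtain ⟨D, R, hD, hR, hword⟩ := exists_norm_apply_wordFun_le hs hF
  refine ⟨D, R * d, fun n t => ?_⟩
  calc ‖dualTerm hs F n t‖
      ≤ ∑ k : Fin n → Fin d, (∏ i, ‖(t (k i) : ℂ)‖) * (D * R ^ n / (n ! : ℝ)) := by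
        refine norm_sum_le_of_le _ fun k _ => ?_
        rw [norm_mul, norm_div, Complex.norm_natCast, norm_prod]
        gcongr
        exact hword k
    _ ≤ (d * ‖t‖) ^ n * (D * R ^ n / (n ! : ℝ)) := by
        rw [← Finset.sum_mul]
        gcongr
        exact sum_prod_norm_coord_le n t
    _ = _ := by ring

theorem laplaceFun_sub_sum_wordFun (hs : 1 ≤ s) {c : RSp d → ℂ} (hc : ExpIntegrable c volume)
    (N : ℕ) :
    ((laplaceFun hs hc - ∑ n ∈ Finset.range N, ∑ k : Fin n → Fin d,
        ((∫ t, (∏ i, (t (k i) : ℂ)) * c t) / (n ! : ℂ)) • wordFun hs k :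
        gevreySpace s (RSp d × RSp d)) : RSp d × RSp d → ℂ) =
      fun p => positionGaussian p * ∫ t, expTail N (dualForm t p) * c t := by
  ext p
  simp only [Submodule.coe_sub, Submodule.coe_sum, Submodule.coe_smul, Pi.sub_apply,
    Finset.sum_apply, Pi.smul_apply, smul_eq_mul, laplaceFun, wordFun]
  rw [laplaceTransform_eq_sum_add hc N p, add_sub_cancel_left]

theorem apply_laplaceFun_sub_sum_wordFun (hs : 1 ≤ s)
    (F : Module.Dual ℂ (gevreySpace s (RSp d × RSp d))) {c : RSp d → ℂ}
    (hc : ExpIntegrable c volume) (N : ℕ) :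
    F (laplaceFun hs hc - ∑ n ∈ Finset.range N, ∑ k : Fin n → Fin d,
        ((∫ t, (∏ i, (t (k i) : ℂ)) * c t) / (n ! : ℂ)) • wordFun hs k) =
      F (laplaceFun hs hc) - ∑ n ∈ Finset.range N, ∫ t, dualTerm hs F n t * c t := by
  simp only [map_sub, map_sum, map_smul, smul_eq_mul, dualTerm, integral_sum_prod_coord_mul hc,
    div_mul_eq_mul_div, mul_div_assoc]

theorem tendsto_sum_integral_dualTerm_mul (hs : 1 ≤ s)
    {F : Module.Dual ℂ (gevreySpace s (RSp d × RSp d))} (hF : F ∈ gevreyDual s (RSp d × RSp d))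
    {c : RSp d → ℂ} (hc : ExpIntegrable c volume) :
    Filter.Tendsto (fun N => ∑ n ∈ Finset.range N, ∫ t, dualTerm hs F n t * c t) Filter.atTop
      (nhds (F (laplaceFun hs hc))) := by
  obtain ⟨C, R, _, _, hFC⟩ := exists_norm_apply_le_of_mem_gevreyDual hs hF four_pos
  obtain ⟨A, hA⟩ := exists_factorialBoundOn_positionGaussian (d := d) R
  rw [tendsto_iff_norm_sub_tendsto_zero]
  refine squeeze_zero (fun _ => norm_nonneg _) (fun N => ?_) (mul_zero (C * (2 * A *
    ∫ t, Real.exp ((2 * R + 1) * ‖dualForm t‖) * ‖c t‖)) ▸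
      (tendsto_pow_atTop_nhds_zero_of_lt_one one_half_pos.le one_half_lt_one).const_mul _)
  rw [norm_sub_rev, ← apply_laplaceFun_sub_sum_wordFun]
  refine (hFC _ (A := 2 * (A * ((1 / 2) ^ N *
    ∫ t, Real.exp ((2 * R + 1) * ‖dualForm t‖) * ‖c t‖))) ?_).trans_eq (by ring)
  rw [laplaceFun_sub_sum_wordFun]
  exact hA.mul ((hc.factorialBoundOn_integral_expTail dualForm N R).mono_rate zero_le_two
    (by norm_num)) zero_le_two (by norm_num)

theorem exists_density_of_mem_gevreyDual (hs : 1 ≤ s)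
    {F : Module.Dual ℂ (gevreySpace s (RSp d × RSp d))} (hF : F ∈ gevreyDual s (RSp d × RSp d)) :
    ∃ (P : RSp d → ℂ) (C S : ℝ), AEStronglyMeasurable P volume ∧
      (∀ t, ‖P t‖ ≤ C * Real.exp (S * ‖t‖)) ∧
      ∀ (c : RSp d → ℂ) (hc : ExpIntegrable c volume), F (laplaceFun hs hc) = ∫ t, P t * c t := by
  obtain ⟨D, S, hterm⟩ := exists_norm_dualTerm_le hs hF
  have hcont := continuous_dualTerm hs F
  refine ⟨fun t => ∑' n, dualTerm hs F n t, D, S,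
    (Measurable.tsum fun n => (hcont n).measurable).aestronglyMeasurable, fun t => ?_,
    fun c hc => ?_⟩
  · refine tsum_of_norm_bounded ?_ fun n => hterm n t
    rw [Real.exp_eq_exp_ℝ]
    exact (NormedSpace.expSeries_div_hasSum_exp (S * ‖t‖)).mul_left D
  · exact tendsto_nhds_unique (tendsto_sum_integral_dualTerm_mul hs hF hc)
      (hc.hasSum_integral_mul (fun n => (hcont n).aestronglyMeasurable) hterm).tendsto_sum_nat

end Duality

section GaussianDerivatives

/-- The polynomial `(-1)^n H_n`, with `H_n` the physicists' Hermite polynomial: the factor of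
`e^{-t²}` in `(d/dt)^n e^{-t²}`. -/
def gaussPoly (n : ℕ) : Polynomial ℂ :=
  .C ((-(√2 : ℝ)) ^ n : ℂ) *
    ((Polynomial.hermite n).map (Int.castRingHom ℂ)).comp (.C ((√2 : ℝ) : ℂ) * .X)

theorem degree_gaussPoly (n : ℕ) : (gaussPoly n).degree = n := by
  have hsqrt : ((√2 : ℝ) : ℂ) ≠ 0 := by simp
  have hX : (Polynomial.C ((√2 : ℝ) : ℂ) * Polynomial.X).degree = 1 :=
    Polynomial.degree_C_mul_X hsqrt
  rw [gaussPoly, Polynomial.degree_C_mul (pow_ne_zero n (neg_ne_zero.2 hsqrt)),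
    Polynomial.degree_comp (hX ▸ one_pos), hX, mul_one,
    Polynomial.degree_map_eq_of_injective (RingHom.injective_int _), Polynomial.degree_hermite]

/-- The `n`-th derivative of `e^{-t²}`. -/
def gaussDeriv (n : ℕ) : ℝ → ℝ := iteratedDeriv n fun t : ℝ => Real.exp (-t ^ 2)

theorem ofReal_gaussDeriv (n : ℕ) (t : ℝ) :
    (gaussDeriv n t : ℂ) = (gaussPoly n).eval (t : ℂ) * (Real.exp (-t ^ 2) : ℝ) := by
  have hscale : (fun t : ℝ => Real.exp (-t ^ 2)) =
      fun t => (fun y : ℝ => Real.exp (-(y ^ 2 / 2))) (√2 * t) := by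
    ext t
    simp [mul_pow]
  have hderiv : gaussDeriv n t = √2 ^ n * ((-1) ^ n *
      Polynomial.aeval (√2 * t) (Polynomial.hermite n) * Real.exp (-t ^ 2)) := by
    rw [gaussDeriv, hscale, iteratedDeriv_comp_const_mul
      (f := fun y : ℝ => Real.exp (-(y ^ 2 / 2))) (by fun_prop), iteratedDeriv_eq_iterate]
    beta_reduce
    rw [Polynomial.deriv_gaussian_eq_hermite_mul_gaussian, mul_pow, Real.sq_sqrt zero_le_two,
      mul_div_cancel_left₀ _ two_ne_zero]
  have hcast := Polynomial.aeval_algebraMap_apply ℂ (√2 * t) (Polynomial.hermite n)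
  rw [Complex.coe_algebraMap] at hcast
  rw [hderiv, gaussPoly]
  push_cast [← hcast]
  simp only [Polynomial.eval_mul, Polynomial.eval_comp, Polynomial.eval_C, Polynomial.eval_X,
    Polynomial.eval_map, Polynomial.aeval_def, neg_pow (√2 : ℂ), algebraMap_int_eq]
  ring

theorem hasDerivAt_gaussDeriv (n : ℕ) (t : ℝ) :
    HasDerivAt (gaussDeriv n) (gaussDeriv (n + 1) t) t := by
  have hsmooth : ContDiff ℝ ∞ fun t : ℝ => Real.exp (-t ^ 2) := by fun_prop
  rw [gaussDeriv, gaussDeriv, iteratedDeriv_succ, hasDerivAt_deriv_iff]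
  exact hsmooth.differentiable_iteratedDeriv n (by exact_mod_cast WithTop.coe_lt_top n) t

theorem expIntegrable_gaussDeriv (n : ℕ) :
    ExpIntegrable (fun t : ℝ => (gaussDeriv n t : ℂ)) volume := by
  simpa [ofReal_gaussDeriv] using
    (expIntegrable_gaussian (V := ℝ) one_pos).eval_clm_mul (gaussPoly n) Complex.ofRealCLM

theorem integrable_cexp_mul_gaussDeriv (n : ℕ) (z : ℂ) :
    Integrable fun t : ℝ => Complex.exp (t * z) * (gaussDeriv n t : ℂ) :=
  (expIntegrable_gaussDeriv n).integrable_cexp_mul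
    ((ContinuousLinearMap.mul ℝ ℂ).comp Complex.ofRealCLM) z

theorem integral_cexp_mul_gaussDeriv (n : ℕ) (z : ℂ) :
    ∫ t : ℝ, Complex.exp (t * z) * (gaussDeriv n t : ℂ) =
      (-z) ^ n * ((Real.pi : ℂ) ^ (1 / 2 : ℂ) * Complex.exp (z ^ 2 / 4)) := by
  induction n with
  | zero =>
    calc _ = ∫ t : ℝ, Complex.exp (-1 * t ^ 2 + z * t + 0) := by
          congr 1 with t
          simp only [gaussDeriv, iteratedDeriv_zero]
          push_cast
          rw [← Complex.exp_add]
          ring_nf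
      _ = _ := by
          rw [integral_cexp_quadratic (by norm_num)]
          ring_nf
  | succ n ih =>
    have hexp (t : ℝ) : HasDerivAt (fun t : ℝ => Complex.exp (t * z)) (Complex.exp (t * z) * z) t :=
      ((Complex.ofRealCLM.hasDerivAt (x := t)).mul_const z).cexp.congr_deriv (by simp)
    have hint := integrable_cexp_mul_gaussDeriv n z
    have hparts := integral_mul_deriv_eq_deriv_mul_of_integrable (fun t _ => hexp t)
      (fun t _ => (hasDerivAt_gaussDeriv n t).ofReal_comp)
      (integrable_cexp_mul_gaussDeriv (n + 1) z)
      ((hint.mul_const z).congr (.of_forall fun t => mul_right_comm _ _ _)) hint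
    rw [hparts]
    simp_rw [mul_right_comm _ z]
    rw [integral_mul_const, ih]
    ring

end GaussianDerivatives

section HermiteFunctions

variable {d : ℕ}

/-- The real linear form `t ↦ t_j` with complex values. -/
def coordForm (j : Fin d) : RSp d →L[ℝ] ℂ := Complex.ofRealCLM.comp (EuclideanSpace.proj j)

theorem prod_ofReal_gaussDeriv (α : Fin d → ℕ) (t : RSp d) :
    ∏ j, (gaussDeriv (α j) (t j) : ℂ) =
      (∏ j, (gaussPoly (α j)).eval (coordForm j t)) * ((Real.exp (-‖t‖ ^ 2) : ℝ) : ℂ) := by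
  simp only [ofReal_gaussDeriv, Finset.prod_mul_distrib, ← Complex.ofReal_prod, ← Real.exp_sum,
    EuclideanSpace.norm_sq_eq, Real.norm_eq_abs, sq_abs, Finset.sum_neg_distrib]
  rfl

theorem integral_cexp_sum_mul_prod_gaussDeriv (α : Fin d → ℕ) (w : Fin d → ℂ) :
    ∫ t : RSp d, Complex.exp (∑ j, (t j : ℂ) * w j) * ∏ j, (gaussDeriv (α j) (t j) : ℂ) =
      (∏ j, (-w j) ^ α j) * ((Real.pi : ℂ) ^ (d / 2 : ℂ) * Complex.exp ((∑ j, w j ^ 2) / 4)) := by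
  calc _ = ∫ t : RSp d, ∏ j, (Complex.exp ((t j : ℂ) * w j) * (gaussDeriv (α j) (t j) : ℂ)) := by
        simp only [Complex.exp_sum, Finset.prod_mul_distrib]
    _ = ∫ t : Fin d → ℝ, ∏ j, (Complex.exp ((t j : ℂ) * w j) * (gaussDeriv (α j) (t j) : ℂ)) :=
        (EuclideanSpace.volume_preserving_symm_measurableEquiv_toLp (Fin d)).integral_comp
          (MeasurableEquiv.measurableEmbedding _) fun t : Fin d → ℝ =>
            ∏ j, (Complex.exp ((t j : ℂ) * w j) * (gaussDeriv (α j) (t j) : ℂ))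
    _ = ∏ j, ((-w j) ^ α j * ((Real.pi : ℂ) ^ (1 / 2 : ℂ) * Complex.exp (w j ^ 2 / 4))) := by
        rw [integral_fintype_prod_volume_eq_prod fun j (t : ℝ) =>
          Complex.exp ((t : ℂ) * w j) * (gaussDeriv (α j) t : ℂ)]
        simp only [integral_cexp_mul_gaussDeriv]
    _ = _ := by
        rw [Finset.prod_mul_distrib, Finset.prod_mul_distrib, ← Complex.exp_sum,
          ← Finset.sum_div, Finset.prod_const, Finset.card_univ, Fintype.card_fin,
          ← Complex.cpow_nat_mul, mul_one_div]

/-- The normalization `(2^{|α|} α!)^{-1/2}` of the Hermite function `h_α`. -/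
def hermiteNorm (α : Fin d → ℕ) : ℝ :=
  ((2 : ℝ) ^ (∑ j, α j) * ∏ j, ((α j)! : ℝ)) ^ (-(1 / 2) : ℝ)

theorem hermiteNorm_pos (α : Fin d → ℕ) : 0 < hermiteNorm α := by
  have : 0 < ∏ j, ((α j)! : ℝ) := Finset.prod_pos fun j _ => by positivity
  unfold hermiteNorm
  positivity

theorem hermiteNorm_eq (α : Fin d → ℕ) : hermiteNorm α =
    (2 ^ (-(1 / 2) : ℝ)) ^ (∑ j, α j) * (∏ j, ((α j)! : ℝ)) ^ (-(1 / 2) : ℝ) := by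
  rw [hermiteNorm, Real.mul_rpow (by positivity) (Finset.prod_nonneg fun _ _ => by positivity),
    Real.rpow_pow_comm zero_le_two]

theorem ofReal_hermiteFun (α : Fin d → ℕ) (t : RSp d) :
    (hermiteFun α t : ℂ) = (-1) ^ (∑ j, α j) * hermiteNorm α *
      ((∏ j, (gaussPoly (α j)).eval (coordForm j t)) * gaussianWindow d t) := by
  have hexp : Real.exp (-‖t‖ ^ 2 / 2) = Real.exp (‖t‖ ^ 2 / 2) * Real.exp (-‖t‖ ^ 2) := by
    rw [← Real.exp_add]
    ring_nf
  have hdef : hermiteFun α t = Real.pi ^ (-(d : ℝ) / 4) * (-1) ^ (∑ j, α j) * hermiteNorm α *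
      Real.exp (‖t‖ ^ 2 / 2) * ∏ j, gaussDeriv (α j) (t j) := rfl
  rw [hdef, gaussianWindow, hexp]
  push_cast [prod_ofReal_gaussDeriv]
  ring

theorem gaussianWindow_ne_zero (t : RSp d) : gaussianWindow d t ≠ 0 :=
  Complex.ofReal_ne_zero.2 (by positivity)

theorem norm_gaussianWindow_le (t : RSp d) : ‖gaussianWindow d t‖ ≤ Real.pi ^ (-(d : ℝ) / 4) := by
  rw [gaussianWindow, Complex.norm_real, Real.norm_of_nonneg (by positivity)]
  refine mul_le_of_le_one_right (by positivity) (Real.exp_le_one_iff.2 ?_)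
  linarith [sq_nonneg ‖t‖]

theorem gaussianWindow_sq (t : RSp d) :
    gaussianWindow d t ^ 2 = (Real.pi : ℂ) ^ (-d / 2 : ℂ) * ((Real.exp (-‖t‖ ^ 2) : ℝ) : ℂ) := by
  have hπ : ((Real.pi ^ (-(d : ℝ) / 2) : ℝ) : ℂ) = (Real.pi : ℂ) ^ (-d / 2 : ℂ) := by
    push_cast [Complex.ofReal_cpow Real.pi_pos.le]
    rfl
  rw [← hπ, gaussianWindow, ← Complex.ofReal_pow, ← Complex.ofReal_mul, mul_pow, ← Real.exp_nat_mul,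
    ← Real.rpow_mul_natCast Real.pi_pos.le]
  push_cast
  ring_nf

/-- The product `h_α φ`. -/
def hermiteWindow (α : Fin d → ℕ) (t : RSp d) : ℂ := (hermiteFun α t : ℂ) * gaussianWindow d t

theorem hermiteWindow_eq (α : Fin d → ℕ) (t : RSp d) :
    hermiteWindow α t = (Real.pi : ℂ) ^ (-d / 2 : ℂ) * (-1) ^ (∑ j, α j) * hermiteNorm α *
      ∏ j, (gaussDeriv (α j) (t j) : ℂ) := by
  rw [hermiteWindow, ofReal_hermiteFun, prod_ofReal_gaussDeriv]
  linear_combination ((-1) ^ (∑ j, α j) * hermiteNorm α *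
    ∏ j, (gaussPoly (α j)).eval (coordForm j t)) * gaussianWindow_sq t

theorem expIntegrable_hermiteWindow (α : Fin d → ℕ) :
    ExpIntegrable (hermiteWindow α) volume := by
  have hpoly := ((expIntegrable_gaussianWindow d).prod_eval_clm_mul Finset.univ
    (fun j => gaussPoly (α j)) coordForm).const_mul ((-1) ^ (∑ j, α j) * hermiteNorm α)
  have hwindow := hpoly.bounded_mul
    (expIntegrable_gaussianWindow d).aestronglyMeasurable norm_gaussianWindow_le
  simp only [← ofReal_hermiteFun, mul_comm (gaussianWindow d _)] at hwindow
  exact hwindow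

theorem laplaceTransform_hermiteWindow (α : Fin d → ℕ) (p : RSp d × RSp d) :
    laplaceTransform (hermiteWindow α) p = hermiteNorm α * (∏ j, zCoord j p ^ α j) *
      (positionGaussian p * Complex.exp ((∑ j, zCoord j p ^ 2) / 4)) := by
  have hπ : (Real.pi : ℂ) ^ (-d / 2 : ℂ) * (Real.pi : ℂ) ^ (d / 2 : ℂ) = 1 := by
    rw [← Complex.cpow_add _ _ (by simp [Real.pi_ne_zero]), neg_div, neg_add_cancel,
      Complex.cpow_zero]
  have hsign : (-1 : ℂ) ^ (∑ j, α j) * ∏ j, (-zCoord j p) ^ α j = ∏ j, zCoord j p ^ α j := by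
    rw [← Finset.prod_pow_eq_pow_sum, ← Finset.prod_mul_distrib]
    exact Finset.prod_congr rfl fun j _ => by rw [← mul_pow, neg_one_mul, neg_neg]
  simp_rw [laplaceTransform, hermiteWindow_eq, dualForm_eq_sum, mul_left_comm (Complex.exp _)]
  rw [integral_const_mul, integral_cexp_sum_mul_prod_gaussDeriv, ← hsign]
  linear_combination (positionGaussian p * (-1) ^ (∑ j, α j) * (hermiteNorm α : ℂ) *
    (∏ j, (-zCoord j p) ^ α j) * Complex.exp ((∑ j, zCoord j p ^ 2) / 4)) * hπ

theorem laplaceTransform_hermiteWindow_eq_mul_zero (α : Fin d → ℕ) (p : RSp d × RSp d) :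
    laplaceTransform (hermiteWindow α) p =
      (∏ i ∈ Finset.univ.sigma fun j => Finset.range (α j), zCoord i.1 p) *
        laplaceTransform (hermiteWindow 0) p * hermiteNorm α := by
  rw [laplaceTransform_hermiteWindow, laplaceTransform_hermiteWindow, Finset.prod_sigma]
  simp only [Finset.prod_const, Finset.card_range, hermiteNorm, Pi.zero_apply, pow_zero,
    Finset.sum_const_zero, Nat.factorial_zero, Nat.cast_one, Real.one_rpow, Complex.ofReal_one,
    one_pow, mul_one]
  ring

theorem exists_norm_apply_laplaceFun_hermiteWindow_le {s : ℝ} (hs : 1 ≤ s)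
    {F : Module.Dual ℂ (gevreySpace s (RSp d × RSp d))} (hF : F ∈ gevreyDual s (RSp d × RSp d)) :
    ∃ C R : ℝ, 0 < R ∧ ∀ α : Fin d → ℕ, ‖F (laplaceFun hs (expIntegrable_hermiteWindow α))‖ ≤
      C * (R ^ (∑ j, α j) * hermiteNorm α) := by
  obtain ⟨C, R, _, hR, hFC⟩ := exists_norm_apply_le_of_mem_gevreyDual hs hF four_pos
  obtain ⟨A, hA⟩ :=
    (expIntegrable_hermiteWindow (d := d) 0).exists_factorialBoundOn_laplaceTransform R
  refine ⟨C * A, 2 * ((R + 1) * 2), by positivity, fun α => ?_⟩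
  have hbound := (hA.prod_clm_mul (Finset.univ.sigma fun j => Finset.range (α j)) hR
    (fun i => norm_zCoord_le i.1) (by norm_num)).mul_const (hermiteNorm α : ℂ)
  simp only [← laplaceTransform_hermiteWindow_eq_mul_zero] at hbound
  refine (hFC (laplaceFun hs (expIntegrable_hermiteWindow α)) hbound).trans_eq ?_
  rw [Complex.norm_real, Real.norm_of_nonneg (hermiteNorm_pos α).le, Finset.card_sigma]
  simp only [Finset.card_range]
  ring

end HermiteFunctions

section Completeness

open scoped FourierTransform in
theorem ae_eq_zero_of_fourier_eq_zero {V : Type*} [NormedAddCommGroup V] [InnerProductSpace ℝ V]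
    [FiniteDimensional ℝ V] [MeasurableSpace V] [BorelSpace V] {ψ : V → ℂ} (hψ : Integrable ψ)
    (h : ∀ ξ, 𝓕 ψ ξ = 0) : ψ =ᵐ[volume] 0 := by
  refine ae_eq_zero_of_integral_contDiff_smul_eq_zero hψ.locallyIntegrable fun g hg hg' => ?_
  have hsupp : HasCompactSupport (Complex.ofRealCLM ∘ g) := hg'.comp_left rfl
  have hsmooth : ContDiff ℝ ∞ (Complex.ofRealCLM ∘ g) := by fun_prop
  set G : SchwartzMap V ℂ := 𝓕⁻ (hsupp.toSchwartzMap hsmooth) with hG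
  have hfourier (x : V) : 𝓕 (⇑G) x = (g x : ℂ) := by
    rw [← SchwartzMap.fourier_coe, hG, FourierTransform.fourier_fourierInv_eq]
    rfl
  have hswap := VectorFourier.integral_fourierIntegral_smul_eq_flip (L := innerₗ V)
    (μ := volume) (ν := volume) (f := G) (g := ψ)
    Real.continuous_fourierChar continuous_inner (SchwartzMap.integrable _) hψ
  rw [flip_innerₗ] at hswap
  calc ∫ x, g x • ψ x = ∫ x, 𝓕 (⇑G) x • ψ x := by
        simp only [hfourier, Complex.real_smul, smul_eq_mul]
    _ = ∫ x, G x • 𝓕 ψ x := hswap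
    _ = 0 := by simp [h]

variable {d : ℕ}

theorem ae_eq_zero_of_laplaceTransform_eq_zero {ψ : RSp d → ℂ} (hψ : ExpIntegrable ψ volume)
    (h : ∀ p, laplaceTransform ψ p = 0) : ψ =ᵐ[volume] 0 := by
  refine ae_eq_zero_of_fourier_eq_zero hψ.integrable_self fun ξ => ?_
  have hzero := h (0, (-(2 * Real.pi)) • ξ)
  simp only [laplaceTransform, positionGaussian, norm_zero, ne_eq, OfNat.ofNat_ne_zero,
    not_false_eq_true, zero_pow, neg_zero, zero_div, Real.exp_zero, Complex.ofReal_one,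
    one_mul] at hzero
  rw [Real.fourier_eq', ← hzero]
  congr 1 with t
  rw [dualForm_eq_inner, smul_eq_mul]
  simp only [inner_zero_right, inner_smul_right]
  push_cast
  ring_nf

theorem laplaceTransform_eq_zero_of_moments {ψ : RSp d → ℂ} (hψ : ExpIntegrable ψ volume)
    (h : ∀ (n : ℕ) (k : Fin n → Fin d), ∫ t, (∏ i, (t (k i) : ℂ)) * ψ t = 0) (p : RSp d × RSp d) :
    laplaceTransform ψ p = 0 := by
  have hexp (t : RSp d) : Complex.exp (dualForm t p) = ∑' n : ℕ, dualForm t p ^ n / (n ! : ℂ) := by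
    rw [Complex.exp_eq_exp_ℂ, NormedSpace.exp_eq_tsum_div]
  have hsum := hψ.hasSum_integral_mul (p := fun n t => dualForm t p ^ n / (n ! : ℂ)) (D := 1)
    (S := ‖(dualForm : RSp d →L[ℝ] _)‖ * ‖p‖)
    (fun n => (by fun_prop : Continuous _).aestronglyMeasurable) fun n t => by
      rw [norm_div, norm_pow, Complex.norm_natCast, one_mul, mul_right_comm]
      gcongr
      exact dualForm.le_opNorm₂ t p
  simp only [dualForm_pow_div_factorial, integral_sum_prod_coord_mul hψ, h, zero_mul,
    Finset.sum_const_zero] at hsum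
  simp only [← dualForm_pow_div_factorial, ← hexp] at hsum
  rw [laplaceTransform, hsum.unique hasSum_zero, mul_zero]

theorem integral_prod_eval_mul_eq_zero {ψ : RSp d → ℂ} (hψ : ExpIntegrable ψ volume)
    (S : Polynomial.Sequence ℂ)
    (h : ∀ α : Fin d → ℕ, ∫ t, (∏ j, (S (α j)).eval (coordForm j t)) * ψ t = 0)
    (q : Fin d → Polynomial ℂ) : ∫ t, (∏ j, (q j).eval (coordForm j t)) * ψ t = 0 := by
  let nullSpace : Submodule ℂ (RSp d → ℂ) :=
    { carrier := {g | Integrable (fun t => g t * ψ t) ∧ ∫ t, g t * ψ t = 0}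
      zero_mem' := by simp
      add_mem' := fun {f g} hf hg => by
        simp only [Set.mem_ofPred_eq, Pi.add_apply, add_mul]
        exact ⟨hf.1.add hg.1, by rw [integral_add hf.1 hg.1, hf.2, hg.2, add_zero]⟩
      smul_mem' := fun a g hg => by
        simp only [Set.mem_ofPred_eq, Pi.smul_apply, smul_eq_mul, mul_assoc]
        exact ⟨hg.1.const_mul a, by rw [integral_const_mul, hg.2, mul_zero]⟩ }
  let prodEval : MultilinearMap ℂ (fun _ : Fin d => Polynomial ℂ) (RSp d → ℂ) :=
    (MultilinearMap.mkPiAlgebra ℂ (Fin d) (RSp d → ℂ)).compLinearMap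
      fun j => (Polynomial.aeval (coordForm j : RSp d → ℂ)).toLinearMap
  have hprod (q : Fin d → Polynomial ℂ) (t : RSp d) :
      prodEval q t = ∏ j, (q j).eval (coordForm j t) := by
    simp [prodEval]
  have hmem (q : Fin d → Polynomial ℂ) : prodEval q ∈ nullSpace ↔
      ∫ t, (∏ j, (q j).eval (coordForm j t)) * ψ t = 0 := by
    have hint := (hψ.prod_eval_clm_mul Finset.univ q coordForm).integrable_self
    simp [nullSpace, hprod, hint]
  have hunit (i : ℕ) : IsUnit (S i).leadingCoeff :=
    (Polynomial.leadingCoeff_ne_zero.2 (S.ne_zero i)).isUnit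
  have hzero : nullSpace.mkQ.compMultilinearMap prodEval = 0 :=
    Module.Basis.ext_multilinear (fun _ => S.basis hunit) fun α => by
      simpa [Polynomial.Sequence.basis_eq_self] using (hmem _).2 (h α)
  exact (hmem q).1 ((Submodule.Quotient.mk_eq_zero _).1 (DFunLike.congr_fun hzero q))

theorem prod_comp_eq_prod_pow_card {ι κ R : Type*} [Fintype ι] [Fintype κ] [DecidableEq κ]
    [CommMonoid R] (k : ι → κ) (x : κ → R) :
    ∏ i, x (k i) = ∏ j, x j ^ (Finset.univ.filter fun i => k i = j).card := by
  rw [Finset.prod_comp]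
  exact Finset.prod_subset (Finset.subset_univ _) fun j _ hj => by
    have hempty : (Finset.univ.filter fun i => k i = j) = ∅ :=
      Finset.filter_false_of_mem fun i _ hij => hj (Finset.mem_image.2 ⟨i, Finset.mem_univ i, hij⟩)
    rw [hempty, Finset.card_empty, pow_zero]

theorem memLp_exp_mul_gaussianWindow (R : ℝ) :
    MemLp (fun t : RSp d => Real.exp (R * ‖t‖) * ‖gaussianWindow d t‖) 2 volume := by
  have hwindow := expIntegrable_gaussianWindow d
  have hmeas : AEStronglyMeasurable (fun t : RSp d => Real.exp (R * ‖t‖) * ‖gaussianWindow d t‖)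
      volume := (by fun_prop : Continuous fun t : RSp d => Real.exp (R * ‖t‖))
        |>.aestronglyMeasurable.mul hwindow.aestronglyMeasurable.norm
  refine (memLp_two_iff_integrable_sq hmeas).2 ?_
  refine ((hwindow.integrable (2 * R)).const_mul (Real.pi ^ (-(d : ℝ) / 4))).mono' (hmeas.pow 2)
    (.of_forall fun t => ?_)
  rw [Real.norm_of_nonneg (by positivity), mul_pow, sq ‖gaussianWindow d t‖, ← Real.exp_nat_mul]
  calc _ ≤ Real.exp ((2 : ℕ) * (R * ‖t‖)) *
        (Real.pi ^ (-(d : ℝ) / 4) * ‖gaussianWindow d t‖) := by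
        gcongr
        exact norm_gaussianWindow_le t
    _ = _ := by
        push_cast
        ring_nf

theorem expIntegrable_mul_gaussianWindow_of_memLp {f : RSp d → ℂ} (hf : MemLp f 2 volume) :
    ExpIntegrable (fun t => f t * gaussianWindow d t) volume := by
  refine ⟨hf.1.mul (expIntegrable_gaussianWindow d).aestronglyMeasurable, fun R => ?_⟩
  refine (hf.norm.integrable_mul (memLp_exp_mul_gaussianWindow R)).congr (.of_forall fun t => ?_)
  simp only [Pi.mul_apply, norm_mul]
  ring

theorem integral_prod_gaussPoly_mul_eq_zero {f : RSp d → ℂ} {α : Fin d → ℕ}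
    (h : hermiteCoeff f α = 0) :
    ∫ t, (∏ j, (gaussPoly (α j)).eval (coordForm j t)) * (f t * gaussianWindow d t) = 0 := by
  have hconst : ((-1) ^ (∑ j, α j) * hermiteNorm α : ℂ) ≠ 0 :=
    mul_ne_zero (pow_ne_zero _ (by norm_num)) (Complex.ofReal_ne_zero.2 (hermiteNorm_pos α).ne')
  simp_rw [hermiteCoeff, ofReal_hermiteFun, mul_left_comm (f _)] at h
  rw [integral_const_mul] at h
  exact (mul_eq_zero.1 h).resolve_left hconst

theorem ae_eq_zero_of_hermiteCoeff_eq_zero {f : RSp d → ℂ} (hf : MemLp f 2 volume)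
    (h : ∀ α, hermiteCoeff f α = 0) : f =ᵐ[volume] 0 := by
  have hψ := expIntegrable_mul_gaussianWindow_of_memLp hf
  have hmoments (q : Fin d → Polynomial ℂ) := integral_prod_eval_mul_eq_zero hψ
    ⟨gaussPoly, degree_gaussPoly⟩ (fun α => integral_prod_gaussPoly_mul_eq_zero (h α)) q
  have hlaplace := laplaceTransform_eq_zero_of_moments hψ fun n k => by
    simp_rw [fun t : RSp d => prod_comp_eq_prod_pow_card k fun j => (t j : ℂ)]
    simpa [coordForm] using
      hmoments fun j => Polynomial.X ^ (Finset.univ.filter fun i => k i = j).card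
  filter_upwards [ae_eq_zero_of_laplaceTransform_eq_zero hψ hlaplace] with t ht
  exact (mul_eq_zero.1 ht).resolve_right (gaussianWindow_ne_zero t)

end Completeness

section GelfandShilov

theorem exists_norm_gelfandShilov_le {s : ℝ} {E : Type*} [NormedAddCommGroup E] [NormedSpace ℝ E]
    (g : gelfandShilov s E) : ∃ C : ℝ, ∀ t, ‖(g : E → ℂ) t‖ ≤ C := by
  obtain ⟨_, M, _, _, hbound⟩ := g.2.2
  exact ⟨M, fun t => by simpa using hbound 0 0 t⟩

theorem gelfandShilovConj_conj {s : ℝ} {E : Type*} [NormedAddCommGroup E] [NormedSpace ℝ E]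
    (g : gelfandShilov s E) : gelfandShilovConj (gelfandShilovConj g) = g := by
  ext x
  simp [gelfandShilovConj]

variable {d : ℕ} {s : ℝ}

theorem expIntegrable_gelfandShilov_mul (g : gelfandShilov s (RSp d)) :
    ExpIntegrable (fun t => (g : RSp d → ℂ) t * gaussianWindow d t) volume := by
  obtain ⟨C, hC⟩ := exists_norm_gelfandShilov_le g
  exact (expIntegrable_gaussianWindow d).bounded_mul g.2.1.continuous.aestronglyMeasurable hC

theorem conj_stft_gelfandShilov (g : gelfandShilov s (RSp d)) (p : RSp d × RSp d) :
    conj (stft (gaussianWindow d) (g : RSp d → ℂ) p) = laplaceTransform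
      (fun t => (gelfandShilovConj g : RSp d → ℂ) t * gaussianWindow d t) p :=
  conj_stft_gaussianWindow _ _

end GelfandShilov

section Adjoint

variable {d : ℕ} {s : ℝ}

theorem exists_memLp_of_mem_gevreyDual (hs : 1 ≤ s)
    {F : Module.Dual ℂ (gevreySpace s (RSp d × RSp d))} (hF : F ∈ gevreyDual s (RSp d × RSp d)) :
    ∃ f₀ : RSp d → ℂ, MemLp f₀ 2 volume ∧
      ∀ (g : RSp d → ℂ) (hg : ExpIntegrable (fun t => g t * gaussianWindow d t) volume),
        F (laplaceFun hs hg) = ∫ t, f₀ t * g t := by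
  obtain ⟨P, C, S, hP, hle, hdensity⟩ := exists_density_of_mem_gevreyDual hs hF
  refine ⟨fun t => P t * gaussianWindow d t, ?_, fun g hg => ?_⟩
  · refine ((memLp_exp_mul_gaussianWindow S).const_mul C).mono
      (hP.mul (expIntegrable_gaussianWindow d).aestronglyMeasurable) (.of_forall fun t => ?_)
    refine le_trans ?_ (le_abs_self _)
    rw [norm_mul, ← mul_assoc]
    gcongr
    exact hle t
  · rw [hdensity _ hg]
    simp only [mul_left_comm (P _), mul_comm (P _ * _)]

theorem IsStftAdjoint.eq_integral (hs : 1 ≤ s)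
    {F : Module.Dual ℂ (gevreySpace s (RSp d × RSp d))}
    {f : Module.Dual ℂ (gelfandShilov (1 / 2) (RSp d))}
    (h : IsStftAdjoint (gaussianWindow d) F f) {f₀ : RSp d → ℂ}
    (hf₀ : ∀ (g : RSp d → ℂ) (hg : ExpIntegrable (fun t => g t * gaussianWindow d t) volume),
        F (laplaceFun hs hg) = ∫ t, f₀ t * g t) (g : gelfandShilov (1 / 2) (RSp d)) :
    f g = ∫ t, f₀ t * (g : RSp d → ℂ) t := by
  obtain ⟨G, hG, hf⟩ := h (gelfandShilovConj g)
  rw [gelfandShilovConj_conj] at hf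
  rw [hf, ← hf₀ _ (expIntegrable_gelfandShilov_mul g)]
  congr 1
  ext p
  rw [hG, conj_stft_gelfandShilov, gelfandShilovConj_conj]
  rfl

theorem memPilipovicFlat_of_isStftAdjoint (hs : 1 ≤ s)
    {F : Module.Dual ℂ (gevreySpace s (RSp d × RSp d))} (hF : F ∈ gevreyDual s (RSp d × RSp d))
    {f : Module.Dual ℂ (gelfandShilov (1 / 2) (RSp d))}
    (h : IsStftAdjoint (gaussianWindow d) F f) : MemPilipovicFlat 1 f := by
  obtain ⟨f₀, hf₀, hF₀⟩ := exists_memLp_of_mem_gevreyDual hs hF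
  refine ⟨f₀, ⟨hf₀, ?_⟩, h.eq_integral hs hF₀⟩
  obtain ⟨C, R, hR, hC⟩ := exists_norm_apply_laplaceFun_hermiteWindow_le hs hF
  refine ⟨fun _ => R * 2 ^ (-(1 / 2) : ℝ), fun _ => by positivity, C, fun α => ?_⟩
  rw [hermiteCoeff, ← hF₀ _ (expIntegrable_hermiteWindow α)]
  refine (hC α).trans_eq ?_
  rw [Finset.prod_pow_eq_pow_sum, mul_pow, hermiteNorm_eq, mul_one, mul_assoc]

theorem IsBoundedCompactlySupported.integrable_mul {F : RSp d × RSp d → ℂ}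
    (hF : IsBoundedCompactlySupported F) {G : RSp d × RSp d → ℂ} (hG : Continuous G) :
    Integrable (fun p => F p * G p) := by
  have hsub : Function.support (fun p => F p * G p) ⊆ tsupport F := fun p hp =>
    subset_tsupport F (left_ne_zero_of_mul hp)
  rw [← integrableOn_iff_integrable_of_support_subset hsub]
  have hi : IntegrableOn G (tsupport F) := hG.continuousOn.integrableOn_compact hF.2
  exact hi.mul_of_top_right (hF.1.restrict _)

/-- A bounded function of compact support as a Gevrey distribution. -/
def functionDual (s : ℝ) {F : RSp d × RSp d → ℂ} (hF : IsBoundedCompactlySupported F) :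
    Module.Dual ℂ (gevreySpace s (RSp d × RSp d)) where
  toFun G := ∫ p, F p * (G : RSp d × RSp d → ℂ) p
  map_add' G H := by
    rw [← integral_add (hF.integrable_mul G.2.1.continuous) (hF.integrable_mul H.2.1.continuous)]
    simp [mul_add]
  map_smul' c G := by
    rw [RingHom.id_apply, smul_eq_mul, ← integral_const_mul]
    simp [mul_left_comm]

theorem functionDual_mem_gevreyDual (s : ℝ) {F : RSp d × RSp d → ℂ}
    (hF : IsBoundedCompactlySupported F) :
    functionDual s hF ∈ gevreyDual s (RSp d × RSp d) := by
  refine ⟨tsupport F, hF.2, fun h _ => ⟨∫ p, ‖F p‖, fun G M _ hb => ?_⟩⟩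
  have hint : Integrable F := by
    simpa using hF.integrable_mul (G := fun _ => 1) continuous_const
  rw [← integral_mul_const]
  refine norm_integral_le_of_norm_le (hint.norm.mul_const M) (.of_forall fun p => ?_)
  rw [norm_mul]
  by_cases hp : p ∈ tsupport F
  · gcongr
    simpa using hb 0 p hp
  · simp [image_eq_zero_of_notMem_tsupport hp]

theorem IsStftAdjointFun.isStftAdjoint (hs : 1 ≤ s) {F : RSp d × RSp d → ℂ}
    (hF : IsBoundedCompactlySupported F) {f : Module.Dual ℂ (gelfandShilov (1 / 2) (RSp d))}
    (h : IsStftAdjointFun (gaussianWindow d) F f) :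
    IsStftAdjoint (gaussianWindow d) (functionDual s hF) f := fun g =>
  ⟨laplaceFun hs (expIntegrable_gelfandShilov_mul (gelfandShilovConj g)),
    fun p => (conj_stft_gelfandShilov g p).symm, by
      simp_rw [h g, conj_stft_gelfandShilov]
      rfl⟩

theorem integrable_mul_hermiteFun {u : RSp d → ℂ} (hu : MemLp u 2 volume) (α : Fin d → ℕ) :
    Integrable fun t => u t * (hermiteFun α t : ℂ) := by
  simp_rw [ofReal_hermiteFun, mul_left_comm (u _)]
  exact ((expIntegrable_mul_gaussianWindow_of_memLp hu).prod_eval_clm_mul Finset.univ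
    (fun j => gaussPoly (α j)) coordForm).integrable_self.const_mul _

theorem ae_eq_of_hermiteCoeff_eq {u v : RSp d → ℂ} (hu : MemLp u 2 volume)
    (hv : MemLp v 2 volume) (h : ∀ α, hermiteCoeff u α = hermiteCoeff v α) : u =ᵐ[volume] v := by
  have hsub : u - v =ᵐ[volume] 0 := ae_eq_zero_of_hermiteCoeff_eq_zero (hu.sub hv) fun α => by
    simp_rw [hermiteCoeff, Pi.sub_apply, sub_mul]
    rw [integral_sub (integrable_mul_hermiteFun hu α) (integrable_mul_hermiteFun hv α)]
    exact sub_eq_zero.2 (h α)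
  filter_upwards [hsub] with t ht using sub_eq_zero.1 ht

theorem isStftAdjointFun_of_hermiteCoeff {F : RSp d × RSp d → ℂ}
    (hF : IsBoundedCompactlySupported F) {f : Module.Dual ℂ (gelfandShilov (1 / 2) (RSp d))}
    {f₀ : RSp d → ℂ} (hf₀ : MemLp f₀ 2 volume)
    (hf : ∀ g : gelfandShilov (1 / 2) (RSp d), f g = ∫ x, f₀ x * (g : RSp d → ℂ) x)
    (h : ∀ α, ∫ p, F p * laplaceTransform (hermiteWindow α) p = hermiteCoeff f₀ α) :
    IsStftAdjointFun (gaussianWindow d) F f := fun g => by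
  obtain ⟨f₁, hf₁, hF₁⟩ := exists_memLp_of_mem_gevreyDual le_rfl (functionDual_mem_gevreyDual 1 hF)
  have hae : f₀ =ᵐ[volume] f₁ := ae_eq_of_hermiteCoeff_eq hf₀ hf₁ fun α =>
    (h α).symm.trans (hF₁ _ (expIntegrable_hermiteWindow α))
  calc f (gelfandShilovConj g) = ∫ t, f₁ t * (gelfandShilovConj g : RSp d → ℂ) t := by
        rw [hf]
        refine integral_congr_ae ?_
        filter_upwards [hae] with t ht
        rw [ht]
    _ = ∫ p, F p * laplaceTransform _ p :=
        (hF₁ _ (expIntegrable_gelfandShilov_mul (gelfandShilovConj g))).symm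
    _ = _ := by simp_rw [conj_stft_gelfandShilov]

end Adjoint

theorem hasSum_pow_apply_exp_neg {X : Type*} [NormedAddCommGroup X] [NormedSpace ℂ X]
    [CompleteSpace X] (T : X →L[ℂ] X) (c : ℂ) (x : X) :
    HasSum (fun n : ℕ => (c ^ n / (n ! : ℂ)) • (T ^ n) (NormedSpace.exp ((-c) • T) x)) x := by
  let _ : NormedAlgebra ℚ (X →L[ℂ] X) := NormedAlgebra.restrictScalars ℚ ℂ _
  have hcomm : Commute (c • T) ((-c) • T) := ((Commute.refl T).smul_left c).smul_right (-c)
  have hexp := NormedSpace.exp_add_of_commute hcomm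
  rw [← add_smul, add_neg_cancel, zero_smul, NormedSpace.exp_zero] at hexp
  have hinv : NormedSpace.exp (c • T) (NormedSpace.exp ((-c) • T) x) = x :=
    (DFunLike.congr_fun hexp x).symm
  have hsum := (NormedSpace.exp_series_hasSum_exp' (𝕂 := ℂ) (c • T)).mapL
    (ContinuousLinearMap.apply ℂ X (NormedSpace.exp ((-c) • T) x))
  rw [ContinuousLinearMap.apply_apply, hinv] at hsum
  refine hsum.congr_fun fun n => ?_
  rw [ContinuousLinearMap.apply_apply, smul_pow, smul_smul, _root_.smul_apply, div_eq_inv_mul]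

section Shift

open BoundedContinuousFunction

variable {ι : Type*} [Fintype ι] [DecidableEq ι]

/-- The operator `a ↦ ∑ⱼ a (· + 2 eⱼ)` on families indexed by multi-indices: it corresponds to
multiplication by `∑ⱼ wⱼ²` on moments against the monomials `w ^ α`. -/
def shiftSum (a : (ι → ℕ) → ℂ) (α : ι → ℕ) : ℂ :=
  ∑ j, a (α + Pi.single j 2)

/-- The operator `shiftSum` on families of growth `R ^ |α|`, as a bounded operator in the
normalized coordinates `x α = a α / R ^ |α|`. -/
def weightedShift (R : ℝ) : ((ι → ℕ) →ᵇ ℂ) →L[ℂ] ((ι → ℕ) →ᵇ ℂ) :=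
  (R : ℂ) ^ 2 • ∑ j, compContinuousCLM ℂ ℂ ⟨fun α => α + Pi.single j 2, by fun_prop⟩

theorem weightedShift_apply (R : ℝ) (x : (ι → ℕ) →ᵇ ℂ) (α : ι → ℕ) :
    weightedShift R x α = (R : ℂ) ^ 2 * ∑ j, x (α + Pi.single j 2) := by
  simp [weightedShift]

theorem weightedShift_pow_apply (R : ℝ) (n : ℕ) (x : (ι → ℕ) →ᵇ ℂ) (α : ι → ℕ) :
    (R : ℂ) ^ (∑ j, α j) * (weightedShift R ^ n) x α =
      (shiftSum^[n] fun α => (R : ℂ) ^ (∑ j, α j) * x α) α := by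
  induction n generalizing α with
  | zero => simp
  | succ n ih =>
    rw [pow_succ', mul_apply_eq_comp, weightedShift_apply,
      Function.iterate_succ_apply', shiftSum, Finset.mul_sum, Finset.mul_sum]
    refine Finset.sum_congr rfl fun j _ => ?_
    rw [← ih, ← mul_assoc, ← pow_add]
    congr 2
    simp [Finset.sum_add_distrib]

theorem exists_hasSum_iterate_shiftSum {a : (ι → ℕ) → ℂ} {C R : ℝ} (hR : 0 < R)
    (ha : ∀ α, ‖a α‖ ≤ C * R ^ (∑ j, α j)) (c : ℂ) :
    ∃ (b : (ι → ℕ) → ℂ) (C' : ℝ), (∀ α, ‖b α‖ ≤ C' * R ^ (∑ j, α j)) ∧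
      ∀ α, HasSum (fun n : ℕ => c ^ n / (n ! : ℂ) * (shiftSum^[n] b) α) (a α) := by
  have hRC : (R : ℂ) ≠ 0 := by exact_mod_cast hR.ne'
  have norm_pow_R (n : ℕ) : ‖(R : ℂ) ^ n‖ = R ^ n := by
    rw [norm_pow, Complex.norm_real, Real.norm_of_nonneg hR.le]
  let x : (ι → ℕ) →ᵇ ℂ := ofNormedAddCommGroupDiscrete
    (fun α => a α / (R : ℂ) ^ (∑ j, α j)) C fun α => by
      rw [norm_div, norm_pow_R, div_le_iff₀ (by positivity)]
      exact ha α
  have hxa (α : ι → ℕ) : (R : ℂ) ^ (∑ j, α j) * x α = a α :=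
    mul_div_cancel₀ _ (pow_ne_zero _ hRC)
  set y := NormedSpace.exp ((-c) • weightedShift R) x
  refine ⟨fun α => (R : ℂ) ^ (∑ j, α j) * y α, ‖y‖, fun α => ?_, fun α => ?_⟩
  · rw [norm_mul, norm_pow_R, mul_comm]
    gcongr
    exact y.norm_coe_le_norm α
  · have hsum := ((hasSum_pow_apply_exp_neg (weightedShift R) c x).mapL (evalCLM ℂ α)).mul_left
      ((R : ℂ) ^ (∑ j, α j))
    rw [evalCLM_apply, hxa] at hsum
    refine hsum.congr_fun fun n => ?_
    rw [← weightedShift_pow_apply, map_smul, smul_eq_mul, evalCLM_apply]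
    ring

end Shift

theorem exists_circle_conj_pow_mul_pow_eq_neg_one {m n : ℕ} (hmn : m ≠ n) :
    ∃ c : Circle, conj (c : ℂ) ^ m * (c : ℂ) ^ n = -1 := by
  have hsub : (n : ℂ) - m ≠ 0 := sub_ne_zero.2 (by exact_mod_cast hmn.symm)
  refine ⟨Circle.exp (Real.pi / ((n : ℝ) - m)), ?_⟩
  rw [Circle.coe_exp, ← Complex.exp_conj, ← Complex.exp_nat_mul, ← Complex.exp_nat_mul,
    ← Complex.exp_add, ← Complex.exp_pi_mul_I, map_mul, Complex.conj_I, Complex.conj_ofReal]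
  congr 1
  push_cast
  field_simp
  ring

theorem integral_conj_pow_mul_pow_mul_norm_eq_zero {m n : ℕ} (hmn : m ≠ n) (u : ℝ → ℂ) :
    ∫ w : ℂ, conj w ^ m * w ^ n * u ‖w‖ = 0 := by
  obtain ⟨c, hc⟩ := exists_circle_conj_pow_mul_pow_eq_neg_one hmn
  have hrot (w : ℂ) : conj (rotation c w) ^ m * rotation c w ^ n * u ‖rotation c w‖ =
      -(conj w ^ m * w ^ n * u ‖w‖) := by
    rw [LinearIsometryEquiv.norm_map, rotation_apply, map_mul, mul_pow, mul_pow]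
    linear_combination (conj w ^ m * w ^ n * u ‖w‖) * hc
  have hinv := (rotation c).measurePreserving.integral_comp
    (rotation c).toHomeomorph.measurableEmbedding fun w => conj w ^ m * w ^ n * u ‖w‖
  simp only [hrot, integral_neg] at hinv
  exact self_eq_neg.1 hinv.symm

/-- The Gaussian moments of the disc of radius `ρ`. -/
def discMoment (ρ : ℝ) (n : ℕ) : ℝ :=
  ∫ w in Metric.closedBall (0 : ℂ) ρ, ‖w‖ ^ (2 * n) * Real.exp (-‖w‖ ^ 2 / 4)

theorem setIntegral_closedBall_conj_pow_mul_pow (ρ : ℝ) (m n : ℕ) :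
    ∫ w in Metric.closedBall (0 : ℂ) ρ,
      conj w ^ m * w ^ n * ((Real.exp (-‖w‖ ^ 2 / 4) : ℝ) : ℂ) =
      if m = n then (discMoment ρ n : ℂ) else 0 := by
  split_ifs with hmn
  · rw [hmn, discMoment, ← integral_complex_ofReal]
    congr 1 with w
    rw [← mul_pow, Complex.conj_mul', pow_mul]
    push_cast
    rfl
  · rw [← integral_indicator Metric.isClosed_closedBall.measurableSet]
    refine Eq.trans ?_ (integral_conj_pow_mul_pow_mul_norm_eq_zero hmn
      ((Set.Iic ρ).indicator fun r => ((Real.exp (-r ^ 2 / 4) : ℝ) : ℂ)))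
    congr 1 with w
    by_cases hw : ‖w‖ ≤ ρ <;> simp [Set.indicator, hw]

theorem half_le_norm_and_norm_le_of_mem_ball {ρ : ℝ} (hρ : 0 ≤ ρ) {w : ℂ}
    (hw : w ∈ Metric.ball ((3 * ρ / 4 : ℝ) : ℂ) (ρ / 4)) : ρ / 2 ≤ ‖w‖ ∧ ‖w‖ ≤ ρ := by
  rw [mem_ball_iff_norm] at hw
  have hcenter : ‖((3 * ρ / 4 : ℝ) : ℂ)‖ = 3 * ρ / 4 := by
    rw [Complex.norm_real, Real.norm_of_nonneg (by positivity)]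
  have hdist := abs_le.1 (abs_norm_sub_norm_le w ((3 * ρ / 4 : ℝ) : ℂ))
  rw [hcenter] at hdist
  constructor <;> linarith

theorem exists_discMoment_ge {ρ : ℝ} (hρ : 0 < ρ) :
    ∃ δ : ℝ, 0 < δ ∧ ∀ n, δ * (ρ / 2) ^ (2 * n) ≤ discMoment ρ n := by
  set B := Metric.ball ((3 * ρ / 4 : ℝ) : ℂ) (ρ / 4)
  have hBρ : B ⊆ Metric.closedBall 0 ρ := fun w hw =>
    mem_closedBall_zero_iff.2 (half_le_norm_and_norm_le_of_mem_ball hρ.le hw).2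
  have hBfin : volume B ≠ ⊤ := measure_ball_lt_top.ne
  have hBpos : 0 < volume.real B := ENNReal.toReal_pos
    (Metric.measure_ball_pos volume _ (by positivity)).ne' hBfin
  refine ⟨Real.exp (-ρ ^ 2 / 4) * volume.real B, by positivity, fun n => ?_⟩
  have hcont : Continuous (fun w : ℂ => ‖w‖ ^ (2 * n) * Real.exp (-‖w‖ ^ 2 / 4)) := by fun_prop
  have hint := hcont.continuousOn.integrableOn_compact (μ := volume)
    (isCompact_closedBall (0 : ℂ) ρ)
  calc _ = ∫ _w in B, (ρ / 2) ^ (2 * n) * Real.exp (-ρ ^ 2 / 4) := by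
        rw [setIntegral_const, smul_eq_mul]
        ring
    _ ≤ ∫ w in B, ‖w‖ ^ (2 * n) * Real.exp (-‖w‖ ^ 2 / 4) := by
        refine setIntegral_mono_on (integrableOn_const hBfin) (hint.mono_set hBρ)
          Metric.isOpen_ball.measurableSet fun w hw => ?_
        obtain ⟨hle, hge⟩ := half_le_norm_and_norm_le_of_mem_ball hρ.le hw
        gcongr
    _ ≤ discMoment ρ n :=
        setIntegral_mono_set hint (.of_forall fun w => by positivity) hBρ.eventuallyLE

theorem discMoment_pos {ρ : ℝ} (hρ : 0 < ρ) (n : ℕ) : 0 < discMoment ρ n := by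
  obtain ⟨δ, hδ, hge⟩ := exists_discMoment_ge hρ
  exact lt_of_lt_of_le (by positivity) (hge n)

section RadialMoments

variable {ι : Type*} [Fintype ι]

theorem exists_prod_discMoment_ge {ρ : ℝ} (hρ : 0 < ρ) :
    ∃ δ : ℝ, 0 < δ ∧
      ∀ α : ι → ℕ, δ * ((ρ / 2) ^ 2) ^ (∑ j, α j) ≤ ∏ j, discMoment ρ (α j) := by
  obtain ⟨δ, hδ, hge⟩ := exists_discMoment_ge hρ
  refine ⟨δ ^ Fintype.card ι, by positivity, fun α => ?_⟩
  calc δ ^ Fintype.card ι * ((ρ / 2) ^ 2) ^ (∑ j, α j) = ∏ j, δ * (ρ / 2) ^ (2 * α j) := by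
        rw [Finset.prod_mul_distrib, Finset.prod_pow_eq_pow_sum, ← Finset.mul_sum, pow_mul]
        simp
    _ ≤ ∏ j, discMoment ρ (α j) :=
        Finset.prod_le_prod (fun j _ => by positivity) fun j _ => hge (α j)

/-- The Gaussian weight `e^{-|w|²/4}` on `ℂ^ι`. -/
def radialGaussian (w : ι → ℂ) : ℂ :=
  ∏ j, ((Real.exp (-‖w j‖ ^ 2 / 4) : ℝ) : ℂ)

@[fun_prop]
theorem continuous_radialGaussian : Continuous (radialGaussian (ι := ι)) := by
  unfold radialGaussian
  fun_prop

theorem setIntegral_closedBall_prod_conj_pow_mul_pow {ρ : ℝ} (hρ : 0 ≤ ρ)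
    (β α : ι → ℕ) :
    ∫ w in Metric.closedBall (0 : ι → ℂ) ρ,
      (∏ j, conj (w j) ^ β j) * (∏ j, w j ^ α j) * radialGaussian w =
      if β = α then ((∏ j, discMoment ρ (α j) : ℝ) : ℂ) else 0 := by
  rw [closedBall_pi _ hρ, volume_pi, Measure.restrict_pi_pi]
  simp only [radialGaussian, ← Finset.prod_mul_distrib, Pi.zero_apply]
  rw [integral_fintype_prod_eq_prod (fun (j : ι) (w : ℂ) =>
    conj w ^ β j * w ^ α j * ((Real.exp (-‖w‖ ^ 2 / 4) : ℝ) : ℂ))]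
  simp only [setIntegral_closedBall_conj_pow_mul_pow]
  split_ifs with h
  · simp [h]
  · obtain ⟨j, hj⟩ := Function.ne_iff.1 h
    exact Finset.prod_eq_zero (Finset.mem_univ j) (if_neg hj)

end RadialMoments

theorem hasSum_setIntegral_of_norm_le {X E ι : Type*} [MeasurableSpace X] {μ : Measure X}
    [NormedAddCommGroup E] [NormedSpace ℝ E] [Countable ι] {K : Set X} (hK : MeasurableSet K)
    (hμK : μ K ≠ ⊤) {F : ι → X → E} {f : X → E} {c : ι → ℝ} (hc : Summable c)
    (hF : ∀ n, AEStronglyMeasurable (F n) (μ.restrict K))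
    (hFc : ∀ n, ∀ x ∈ K, ‖F n x‖ ≤ c n) (hsum : ∀ x ∈ K, HasSum (fun n => F n x) (f x)) :
    HasSum (fun n => ∫ x in K, F n x ∂μ) (∫ x in K, f x ∂μ) :=
  hasSum_integral_of_dominated_convergence (fun n _ => c n) hF
    (fun n => ae_restrict_of_forall_mem hK (hFc n)) (.of_forall fun _ => hc)
    (integrableOn_const hμK) (ae_restrict_of_forall_mem hK hsum)

section Words

variable {κ : Type*} [DecidableEq κ]

/-- The multi-index counting the occurrences of each letter in the word `k`. -/
def wordCount {n : ℕ} (k : Fin n → κ) (j : κ) : ℕ :=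
  (Finset.univ.filter fun i => k i = j).card

variable [Fintype κ]

theorem sum_wordCount {n : ℕ} (k : Fin n → κ) : ∑ j, wordCount k j = n := by
  simpa [wordCount] using
    (Finset.card_eq_sum_card_fiberwise (s := Finset.univ) (t := Finset.univ) (f := k)
      fun _ _ => Finset.mem_coe.2 (Finset.mem_univ _)).symm

theorem exists_wordCount_eq (β : κ → ℕ) : ∃ k : Fin (∑ j, β j) → κ, wordCount k = β := by
  have e : (Σ j, Fin (β j)) ≃ Fin (∑ j, β j) := Fintype.equivFinOfCardEq (by simp)
  refine ⟨fun i => (e.symm i).1, funext fun j => ?_⟩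
  have hcard : wordCount (fun i => (e.symm i).1) j =
      (Finset.univ.filter fun x : Σ j, Fin (β j) => x.1 = j).card :=
    Finset.card_equiv e.symm fun i => by simp
  rw [hcard, ← Fintype.card_subtype, Fintype.card_congr (Equiv.sigmaSubtype j), Fintype.card_fin]

/-- The number of words whose letters occur with the multiplicities `β`, a multinomial
coefficient. -/
def wordMult (β : κ → ℕ) : ℕ :=
  (Finset.univ.filter fun k : Fin (∑ j, β j) → κ => wordCount k = β).card

theorem wordMult_pos (β : κ → ℕ) : 0 < wordMult β := by
  obtain ⟨k, hk⟩ := exists_wordCount_eq β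
  exact Finset.card_pos.2 ⟨k, by simp [hk]⟩

theorem hasSum_sum_ite_wordCount_eq (α : κ → ℕ) (c : ℂ) :
    HasSum (fun n => ∑ k : Fin n → κ, if wordCount k = α then c / wordMult α else 0) c := by
  have hlength : ∑ k : Fin (∑ j, α j) → κ, (if wordCount k = α then c / wordMult α else 0) = c := by
    have hmult : (wordMult α : ℂ) ≠ 0 := by exact_mod_cast (wordMult_pos α).ne'
    rw [← Finset.sum_filter, Finset.sum_const]
    change wordMult α • (c / wordMult α) = c
    rw [nsmul_eq_mul, mul_div_cancel₀ _ hmult]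
  convert hasSum_single (∑ j, α j) fun n hn => ?_ using 1
  · exact hlength.symm
  · exact Finset.sum_eq_zero fun k _ => if_neg fun hk => hn (by rw [← hk, sum_wordCount])

end Words

section MultiSeries

variable {κ : Type*} [Fintype κ]

theorem norm_mkPiAlgebra_compContinuousLinearMap_proj_le {n : ℕ} (k : Fin n → κ) :
    ‖(ContinuousMultilinearMap.mkPiAlgebra ℂ (Fin n) ℂ).compContinuousLinearMap
      fun i => (ContinuousLinearMap.proj (k i) : (κ → ℂ) →L[ℂ] ℂ)‖ ≤ 1 := by
  refine ContinuousMultilinearMap.opNorm_le_bound zero_le_one fun m => ?_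
  simp only [ContinuousMultilinearMap.compContinuousLinearMap_apply,
    ContinuousMultilinearMap.mkPiAlgebra_apply, ContinuousLinearMap.proj_apply, one_mul, norm_prod]
  exact Finset.prod_le_prod (fun _ _ => norm_nonneg _) fun i _ => norm_le_pi_norm (m i) (k i)

variable [DecidableEq κ]

/-- The power series `∑ g β w ^ β` in several variables as a series of multilinear maps: the
coefficient `g β` is distributed evenly among the words with letter multiplicities `β`. -/
def multiSeries (g : (κ → ℕ) → ℂ) : FormalMultilinearSeries ℂ (κ → ℂ) ℂ := fun n =>
  ∑ k : Fin n → κ, (g (wordCount k) / wordMult (wordCount k)) •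
    (ContinuousMultilinearMap.mkPiAlgebra ℂ (Fin n) ℂ).compContinuousLinearMap
      fun i => ContinuousLinearMap.proj (k i)

theorem multiSeries_apply (g : (κ → ℕ) → ℂ) (n : ℕ) (w : κ → ℂ) :
    multiSeries g n (fun _ => w) = ∑ k : Fin n → κ,
      (g (wordCount k) / wordMult (wordCount k)) * ∏ j, w j ^ wordCount k j := by
  simp only [multiSeries, _root_.sum_apply, _root_.smul_apply,
    ContinuousMultilinearMap.compContinuousLinearMap_apply,
    ContinuousMultilinearMap.mkPiAlgebra_apply, ContinuousLinearMap.proj_apply, smul_eq_mul,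
    prod_comp_eq_prod_pow_card _ w, wordCount]

theorem norm_multiSeries_le {g : (κ → ℕ) → ℂ} {C q : ℝ}
    (hg : ∀ β, ‖g β‖ ≤ C * q ^ (∑ j, β j)) (n : ℕ) :
    ‖multiSeries g n‖ ≤ C * (Fintype.card κ * q) ^ n := by
  have hcoeff (k : Fin n → κ) : ‖g (wordCount k) / wordMult (wordCount k)‖ ≤ C * q ^ n := by
    rw [norm_div, Complex.norm_natCast]
    refine (div_le_self (norm_nonneg _) ?_).trans ((hg (wordCount k)).trans_eq ?_)
    · exact_mod_cast wordMult_pos _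
    · rw [sum_wordCount]
  refine (norm_sum_le_of_le (n := fun _ => C * q ^ n) _ fun k _ => ?_).trans_eq ?_
  · rw [norm_smul]
    exact (mul_le_of_le_one_right (norm_nonneg _)
      (norm_mkPiAlgebra_compContinuousLinearMap_proj_le k)).trans (hcoeff k)
  · rw [Finset.sum_const, Finset.card_univ, Fintype.card_fun, Fintype.card_fin, nsmul_eq_mul]
    push_cast
    ring

theorem lt_radius_multiSeries {g : (κ → ℕ) → ℂ} {C q : ℝ} (hq : 0 ≤ q)
    (hg : ∀ β, ‖g β‖ ≤ C * q ^ (∑ j, β j)) {ρ : NNReal} (hρ : ρ ≠ 0)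
    (hqρ : Fintype.card κ * q * ρ < 1) : ↑ρ < (multiSeries g).radius := by
  refine FormalMultilinearSeries.lt_radius_of_isBigO (a := Fintype.card κ * q * ρ) _ hρ
    ⟨neg_one_lt_zero.trans_le (by positivity), hqρ⟩ (.of_bound C (.of_forall fun n => ?_))
  rw [Real.norm_of_nonneg (by positivity), Real.norm_of_nonneg (by positivity),
    mul_pow _ (ρ : ℝ), ← mul_assoc]
  gcongr
  exact norm_multiSeries_le hg n

end MultiSeries

section Moments

variable {ι : Type*} [Fintype ι]

theorem hasSum_setIntegral_closedBall_star {P : FormalMultilinearSeries ℂ (ι → ℂ) ℂ}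
    {ρ : NNReal} (hρ : ↑ρ < P.radius) {u : (ι → ℂ) → ℂ} (hu : Continuous u) :
    HasSum (fun n => ∫ w in Metric.closedBall 0 ρ, P n (fun _ => star w) * u w)
      (∫ w in Metric.closedBall 0 ρ, P.sum (star w) * u w) := by
  have hK : IsCompact (Metric.closedBall (0 : ι → ℂ) ρ) := isCompact_closedBall _ _
  obtain ⟨B, hB⟩ := hK.exists_bound_of_continuousOn hu.continuousOn
  refine hasSum_setIntegral_of_norm_le hK.measurableSet hK.measure_lt_top.ne
    ((P.summable_norm_mul_pow hρ).mul_right B)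
    (fun n => Continuous.aestronglyMeasurable (by fun_prop)) (fun n w hw => ?_) fun w hw => ?_
  · rw [norm_mul]
    gcongr
    · refine ((P n).le_opNorm _).trans ?_
      rw [Finset.prod_const, Finset.card_univ, Fintype.card_fin, norm_star]
      gcongr
      exact mem_closedBall_zero_iff.1 hw
    · exact hB w hw
  · refine (P.hasSum ?_).mul_right (u w)
    rw [mem_eball_zero_iff, enorm_eq_nnnorm, nnnorm_star]
    refine lt_of_le_of_lt ?_ hρ
    exact_mod_cast mem_closedBall_zero_iff.1 hw

theorem exists_norm_div_prod_discMoment_le {b : (ι → ℕ) → ℂ} {C R : ℝ}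
    (hb : ∀ α, ‖b α‖ ≤ C * R ^ (∑ j, α j)) {ρ : ℝ} (hρ : 0 < ρ) :
    ∃ C' : ℝ, ∀ α, ‖b α / ((∏ j, discMoment ρ (α j) : ℝ) : ℂ)‖ ≤
      C' * (R * (2 / ρ) ^ 2) ^ (∑ j, α j) := by
  obtain ⟨δ, hδ, hge⟩ := exists_prod_discMoment_ge (ι := ι) hρ
  refine ⟨C / δ, fun α => ?_⟩
  have hmoment : 0 < ∏ j, discMoment ρ (α j) := Finset.prod_pos fun j _ => discMoment_pos hρ (α j)
  have hratio : C / δ * (R * (2 / ρ) ^ 2) ^ (∑ j, α j) * (δ * ((ρ / 2) ^ 2) ^ (∑ j, α j)) =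
      C * R ^ (∑ j, α j) := by
    rw [mul_mul_mul_comm, div_mul_cancel₀ _ hδ.ne', ← mul_pow]
    congr 2
    field_simp
  have hcoeff : 0 ≤ C / δ * (R * (2 / ρ) ^ 2) ^ (∑ j, α j) :=
    nonneg_of_mul_nonneg_left (hratio ▸ (norm_nonneg _).trans (hb α)) (by positivity)
  rw [norm_div, Complex.norm_real, Real.norm_of_nonneg hmoment.le, div_le_iff₀ hmoment]
  exact (hb α).trans (hratio.symm.trans_le (mul_le_mul_of_nonneg_left (hge α) hcoeff))

theorem setIntegral_closedBall_multiSeries_star [DecidableEq ι] (g : (ι → ℕ) → ℂ) {ρ : ℝ}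
    (hρ : 0 ≤ ρ) (α : ι → ℕ) (n : ℕ) :
    ∫ w in Metric.closedBall (0 : ι → ℂ) ρ,
      multiSeries g n (fun _ => star w) * (radialGaussian w * ∏ j, w j ^ α j) =
    ∑ k : Fin n → ι, if wordCount k = α
      then g α * ((∏ j, discMoment ρ (α j) : ℝ) : ℂ) / wordMult α else 0 := by
  simp only [multiSeries_apply, Finset.sum_mul, mul_assoc, mul_comm (radialGaussian _)]
  rw [integral_finsetSum _ fun k _ => ContinuousOn.integrableOn_compact
    (isCompact_closedBall _ _) (Continuous.continuousOn (by fun_prop))]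
  refine Finset.sum_congr rfl fun k _ => ?_
  rw [integral_const_mul]
  simp only [← mul_assoc, Pi.star_apply, RCLike.star_def,
    setIntegral_closedBall_prod_conj_pow_mul_pow hρ]
  split_ifs with hk
  · rw [hk]
    ring
  · rw [mul_zero]

theorem exists_analyticOnNhd_moments {b : (ι → ℕ) → ℂ} {C R : ℝ} (hR : 0 < R)
    (hb : ∀ α, ‖b α‖ ≤ C * R ^ (∑ j, α j)) :
    ∃ (ρ : ℝ) (G : (ι → ℂ) → ℂ), 0 < ρ ∧ AnalyticOnNhd ℂ G (Metric.closedBall 0 ρ) ∧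
      ∀ α, ∫ w in Metric.closedBall (0 : ι → ℂ) ρ,
        G (star w) * radialGaussian w * ∏ j, w j ^ α j = b α := by
  classical
  let ρ : NNReal := ⟨4 * R * (Fintype.card ι + 1), by positivity⟩
  have hρ : 0 < (ρ : ℝ) := by change 0 < 4 * R * ((Fintype.card ι : ℝ) + 1); positivity
  let g (α : ι → ℕ) : ℂ := b α / ((∏ j, discMoment ρ (α j) : ℝ) : ℂ)
  obtain ⟨C', hg⟩ := exists_norm_div_prod_discMoment_le hb hρ
  have hradius : ↑ρ < (multiSeries g).radius := by
    refine lt_radius_multiSeries (by positivity) hg (by exact_mod_cast hρ.ne') ?_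
    have hratio : Fintype.card ι * (R * (2 / ρ) ^ 2) * ρ =
        (Fintype.card ι : ℝ) / (Fintype.card ι + 1) := by
      rw [show (ρ : ℝ) = 4 * R * (Fintype.card ι + 1) from rfl]
      field_simp
      norm_num
    rw [hratio, div_lt_one (by positivity)]
    exact lt_add_one _
  have hseries := (multiSeries g).hasFPowerSeriesOnBall (pos_of_gt hradius)
  refine ⟨ρ, (multiSeries g).sum, hρ, hseries.analyticOnNhd.mono fun w hw => ?_, fun α => ?_⟩
  · rw [mem_eball_zero_iff, enorm_eq_nnnorm]
    refine lt_of_le_of_lt ?_ hradius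
    exact_mod_cast mem_closedBall_zero_iff.1 hw
  · have hmoment_ne : ((∏ j, discMoment ρ (α j) : ℝ) : ℂ) ≠ 0 := by
      exact_mod_cast (Finset.prod_pos fun j _ => discMoment_pos hρ (α j)).ne'
    have hsum := hasSum_setIntegral_closedBall_star hradius
      (u := fun w => radialGaussian w * ∏ j, w j ^ α j) (by fun_prop)
    simp only [setIntegral_closedBall_multiSeries_star g hρ.le] at hsum
    simp only [mul_assoc]
    rw [← div_mul_cancel₀ (b α) hmoment_ne]
    exact hsum.unique (hasSum_sum_ite_wordCount_eq α _)

end Moments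

section TwistedMoments

variable {ι : Type*} [Fintype ι]

theorem prod_pow_add_single [DecidableEq ι] (α : ι → ℕ) (j : ι) (n : ℕ) (w : ι → ℂ) :
    ∏ i, w i ^ (α + Pi.single j n : ι → ℕ) i = w j ^ n * ∏ i, w i ^ α i := by
  simp only [Pi.add_apply, pow_add, Finset.prod_mul_distrib, Pi.single_apply, pow_ite, pow_zero,
    Finset.prod_ite_eq', Finset.mem_univ, if_true, mul_comm]

theorem setIntegral_sum_sq_pow_mul_prod_pow [DecidableEq ι] {K : Set (ι → ℂ)} (hK : IsCompact K)
    {v : (ι → ℂ) → ℂ} (hv : ContinuousOn v K) (n : ℕ) (α : ι → ℕ) :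
    ∫ w in K, v w * ((∑ j, w j ^ 2) ^ n * ∏ j, w j ^ α j) =
      (shiftSum^[n] fun α => ∫ w in K, v w * ∏ j, w j ^ α j) α := by
  induction n generalizing α with
  | zero => simp
  | succ n ih =>
    rw [Function.iterate_succ_apply', shiftSum]
    simp only [← ih]
    have hint (j : ι) : IntegrableOn (fun w => v w * ((∑ i, w i ^ 2) ^ n *
        ∏ i, w i ^ (α + Pi.single j 2 : ι → ℕ) i)) K :=
      (hv.mul (Continuous.continuousOn (by fun_prop))).integrableOn_compact hK
    rw [← integral_finsetSum _ fun j _ => hint j]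
    simp only [prod_pow_add_single, ← Finset.mul_sum, ← Finset.sum_mul, pow_succ _ n, mul_assoc]

theorem hasSum_setIntegral_prod_pow_mul_cexp [DecidableEq ι] {K : Set (ι → ℂ)} (hK : IsCompact K)
    {v : (ι → ℂ) → ℂ} (hv : ContinuousOn v K) (c : ℂ) (α : ι → ℕ) :
    HasSum (fun n : ℕ => c ^ n / (n ! : ℂ) *
        (shiftSum^[n] fun α => ∫ w in K, v w * ∏ j, w j ^ α j) α)
      (∫ w in K, v w * ((∏ j, w j ^ α j) * Complex.exp (c * ∑ j, w j ^ 2))) := by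
  have hprod : ContinuousOn (fun w => v w * ∏ j, w j ^ α j) K :=
    hv.mul (Continuous.continuousOn (by fun_prop))
  obtain ⟨B, hB⟩ := hK.exists_bound_of_continuousOn hprod
  obtain ⟨Q, hQ⟩ := hK.exists_bound_of_continuousOn (f := fun w : ι → ℂ => c * ∑ j, w j ^ 2)
    (by fun_prop)
  simp only [← setIntegral_sum_sq_pow_mul_prod_pow hK hv, ← integral_const_mul]
  have hterm (n : ℕ) (w : ι → ℂ) :
      c ^ n / (n ! : ℂ) * (v w * ((∑ j, w j ^ 2) ^ n * ∏ j, w j ^ α j)) =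
        (c * ∑ j, w j ^ 2) ^ n / (n ! : ℂ) * (v w * ∏ j, w j ^ α j) := by
    rw [mul_pow]
    ring
  simp only [hterm]
  refine hasSum_setIntegral_of_norm_le hK.measurableSet hK.measure_lt_top.ne
    ((Real.summable_pow_div_factorial Q).mul_right B) (fun n => ?_) (fun n w hw => ?_)
    fun w _ => ?_
  · exact (ContinuousOn.mul (Continuous.continuousOn (by fun_prop)) hprod).aestronglyMeasurable
      hK.measurableSet
  · have hQ_nonneg : 0 ≤ Q := (norm_nonneg _).trans (hQ w hw)
    rw [norm_mul, norm_div, norm_pow, Complex.norm_natCast]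
    gcongr
    · exact hQ w hw
    · exact hB w hw
  · have hexp : HasSum (fun n : ℕ => (c * ∑ j, w j ^ 2) ^ n / (n ! : ℂ))
        (Complex.exp (c * ∑ j, w j ^ 2)) := by
      rw [Complex.exp_eq_exp_ℂ]
      exact NormedSpace.expSeries_div_hasSum_exp _
    simpa only [mul_assoc, mul_comm, mul_left_comm] using
      hexp.mul_right (v w * ∏ j, w j ^ α j)

theorem exists_analyticOnNhd_twisted_moments {a : (ι → ℕ) → ℂ} {C R : ℝ} (hR : 0 < R)
    (ha : ∀ α, ‖a α‖ ≤ C * R ^ (∑ j, α j)) (c : ℂ) :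
    ∃ (ρ : ℝ) (G : (ι → ℂ) → ℂ), 0 < ρ ∧ AnalyticOnNhd ℂ G (Metric.closedBall 0 ρ) ∧
      ∀ α, ∫ w in Metric.closedBall (0 : ι → ℂ) ρ, G (star w) * radialGaussian w *
        ((∏ j, w j ^ α j) * Complex.exp (c * ∑ j, w j ^ 2)) = a α := by
  classical
  obtain ⟨b, C', hb, hsum⟩ := exists_hasSum_iterate_shiftSum hR ha c
  obtain ⟨ρ, G, hρ, hG, hmoments⟩ := exists_analyticOnNhd_moments hR hb
  refine ⟨ρ, G, hρ, hG, fun α => ?_⟩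
  have hcont : ContinuousOn (fun w => G (star w) * radialGaussian w) (Metric.closedBall 0 ρ) :=
    (hG.continuousOn.comp continuous_star.continuousOn fun w hw => by
      simpa using hw).mul continuous_radialGaussian.continuousOn
  have htwist := hasSum_setIntegral_prod_pow_mul_cexp (isCompact_closedBall _ _) hcont c α
  rw [funext hmoments] at htwist
  exact htwist.unique (hsum α)

theorem analyticOnNhd_cexp_sum_sq (c : ℂ) (s : Set (ι → ℂ)) :
    AnalyticOnNhd ℂ (fun w : ι → ℂ => Complex.exp (c * ∑ j, w j ^ 2)) s := fun w _ =>
  (analyticAt_const.mul (Finset.analyticAt_fun_sum _ fun j _ =>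
    ((ContinuousLinearMap.proj j : (ι → ℂ) →L[ℂ] ℂ).analyticAt w).pow 2)).cexp

end TwistedMoments

section Polydisc

variable {d : ℕ}

/-- The identification `(x, ξ) ↦ x + iξ` of `ℝ^{2d}` with `ℂ^d`. -/
def complexVec : (RSp d × RSp d) →L[ℝ] (Fin d → ℂ) :=
  ContinuousLinearMap.pi zCoord

theorem complexVec_apply (p : RSp d × RSp d) (j : Fin d) : complexVec p j = zCoord j p := rfl

theorem star_complexVec (p : RSp d × RSp d) :
    star (complexVec p) = fun j => (p.1 j : ℂ) - Complex.I * (p.2 j : ℂ) := by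
  ext j
  simp [complexVec_apply, zCoord_apply, sub_eq_add_neg]

theorem complexVec_injective : Function.Injective (complexVec (d := d)) := fun p q hpq => by
  have hcoord (j : Fin d) : p.1 j = q.1 j ∧ p.2 j = q.2 j := by
    simpa [complexVec_apply, zCoord_apply, Complex.ext_iff] using congrFun hpq j
  exact Prod.ext (PiLp.ext fun j => (hcoord j).1) (PiLp.ext fun j => (hcoord j).2)

theorem isClosedEmbedding_complexVec : Topology.IsClosedEmbedding (complexVec (d := d)) :=
  LinearMap.isClosedEmbedding_of_injective (f := complexVec.toLinearMap)
    (LinearMap.ker_eq_bot.2 complexVec_injective)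

theorem measurePreserving_complexVec : MeasurePreserving (complexVec (d := d)) := by
  have hpair := (EuclideanSpace.volume_preserving_symm_measurableEquiv_toLp (Fin d)).prod
    (EuclideanSpace.volume_preserving_symm_measurableEquiv_toLp (Fin d))
  have hzip := (volume_measurePreserving_arrowProdEquivProdArrow ℝ ℝ (Fin d)).symm
  have hcomplex :=
    volume_preserving_pi fun _ : Fin d => Complex.volume_preserving_equiv_real_prod.symm
  convert hcomplex.comp (hzip.comp hpair) using 1
  · ext p j
    rw [complexVec_apply, zCoord_apply]
    apply Complex.ext <;> simp <;> rfl
  · rfl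

theorem closedPolydisc_const {ρ : ℝ} (hρ : 0 ≤ ρ) :
    closedPolydisc (fun _ : Fin d => ρ) = Metric.closedBall 0 ρ := by
  ext w
  rw [mem_closedBall_zero_iff, pi_norm_le_iff_of_nonneg hρ]
  rfl

theorem isCompact_closedPolydisc (r : Fin d → ℝ) : IsCompact (closedPolydisc r) := by
  convert isCompact_univ_pi fun j => isCompact_closedBall (0 : ℂ) (r j)
  ext w
  simp [closedPolydisc]

theorem isBoundedCompactlySupported_indicator {K : Set (RSp d × RSp d)} (hK : IsCompact K)
    {H : RSp d × RSp d → ℂ} (hH : ContinuousOn H K) :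
    IsBoundedCompactlySupported (K.indicator H) := by
  obtain ⟨B, hB⟩ := hK.exists_bound_of_continuousOn hH
  refine ⟨?_, HasCompactSupport.intro hK fun p hp => Set.indicator_of_notMem hp _⟩
  rw [memLp_indicator_iff_restrict hK.measurableSet]
  exact memLp_top_of_bound (hH.aestronglyMeasurable hK.measurableSet) B
    (ae_restrict_of_forall_mem hK.measurableSet hB)

/-- The function `F₀(x - iξ) e^{-i⟨x, ξ⟩} χ_r(x, ξ)`. -/
def polydiscFun (r : Fin d → ℝ) (F₀ : (Fin d → ℂ) → ℂ) (p : RSp d × RSp d) : ℂ :=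
  F₀ (fun j => (p.1 j : ℂ) - Complex.I * (p.2 j : ℂ)) *
    Complex.exp (-Complex.I * (inner ℝ p.1 p.2 : ℝ)) * polydiscChar r p

theorem polydiscFun_eq_indicator (r : Fin d → ℝ) (F₀ : (Fin d → ℂ) → ℂ) :
    polydiscFun r F₀ = (complexVec ⁻¹' closedPolydisc r).indicator fun p =>
      F₀ (star (complexVec p)) * Complex.exp (-Complex.I * (inner ℝ p.1 p.2 : ℝ)) := by
  ext p
  rw [polydiscFun, ← star_complexVec]
  change _ * (closedPolydisc r).indicator _ (complexVec p) = _
  by_cases hp : complexVec p ∈ closedPolydisc r <;> simp [Set.indicator, hp]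

theorem isBoundedCompactlySupported_polydiscFun {r : Fin d → ℝ} {F₀ : (Fin d → ℂ) → ℂ}
    (hF₀ : ContinuousOn F₀ (closedPolydisc r)) :
    IsBoundedCompactlySupported (polydiscFun r F₀) := by
  rw [polydiscFun_eq_indicator]
  refine isBoundedCompactlySupported_indicator
    (isClosedEmbedding_complexVec.isCompact_preimage (isCompact_closedPolydisc r))
    (ContinuousOn.mul (hF₀.comp (by fun_prop) fun p hp j => ?_)
      (Continuous.continuousOn (by fun_prop)))
  simpa using hp j

theorem cexp_inner_mul_positionGaussian_mul_cexp (p : RSp d × RSp d) :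
    Complex.exp (-Complex.I * (inner ℝ p.1 p.2 : ℝ)) *
      (positionGaussian p * Complex.exp ((∑ j, zCoord j p ^ 2) / 4)) =
    Complex.exp ((∑ j, star (complexVec p) j ^ 2) / 8) * radialGaussian (complexVec p) *
      Complex.exp (-1 / 8 * ∑ j, complexVec p j ^ 2) := by
  have hnorm (j : Fin d) :
      ((‖zCoord j p‖ : ℝ) : ℂ) ^ 2 = (p.1 j : ℂ) ^ 2 + (p.2 j : ℂ) ^ 2 := by
    rw [← Complex.mul_conj', zCoord_apply, map_add, map_mul, Complex.conj_ofReal,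
      Complex.conj_ofReal, Complex.conj_I]
    linear_combination (-(p.2 j : ℂ) ^ 2) * Complex.I_sq
  rw [radialGaussian, ← Complex.ofReal_prod, ← Real.exp_sum, positionGaussian, Complex.ofReal_exp,
    Complex.ofReal_exp, ← Complex.exp_add, ← Complex.exp_add, ← Complex.exp_add, ← Complex.exp_add,
    EuclideanSpace.norm_sq_eq, PiLp.inner_apply, star_complexVec]
  simp only [RCLike.inner_apply, conj_trivial, Real.norm_eq_abs, sq_abs, complexVec_apply]
  push_cast
  simp only [hnorm, Finset.mul_sum, Finset.sum_div, ← Finset.sum_neg_distrib,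
    ← Finset.sum_add_distrib]
  congr 1
  refine Finset.sum_congr rfl fun j _ => ?_
  rw [zCoord_apply]
  linear_combination ((p.2 j : ℂ) ^ 2 / 4) * Complex.I_sq

theorem integral_polydiscFun_mul_laplaceTransform (r : Fin d → ℝ) (F₀ : (Fin d → ℂ) → ℂ)
    (α : Fin d → ℕ) :
    ∫ p, polydiscFun r F₀ p * laplaceTransform (hermiteWindow α) p =
      hermiteNorm α * ∫ w in closedPolydisc r,
        F₀ (star w) * Complex.exp ((∑ j, star w j ^ 2) / 8) * radialGaussian w *
          ((∏ j, w j ^ α j) * Complex.exp (-1 / 8 * ∑ j, w j ^ 2)) := by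
  have hK := (isCompact_closedPolydisc r).measurableSet
  rw [← integral_const_mul, ← measurePreserving_complexVec.setIntegral_preimage_emb
      isClosedEmbedding_complexVec.measurableEmbedding,
    ← integral_indicator (measurePreserving_complexVec.measurable hK), polydiscFun_eq_indicator]
  congr 1 with p
  by_cases hp : p ∈ complexVec ⁻¹' closedPolydisc r
  · rw [Set.indicator_of_mem hp, Set.indicator_of_mem hp, laplaceTransform_hermiteWindow]
    simp only [← complexVec_apply]
    have hexp := cexp_inner_mul_positionGaussian_mul_cexp p
    simp only [← complexVec_apply] at hexp
    linear_combination (hermiteNorm α * (∏ j, complexVec p j ^ α j) * F₀ (star (complexVec p))) *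
      hexp
  · rw [Set.indicator_of_notMem hp, Set.indicator_of_notMem hp, zero_mul]

theorem IsPilipovicFlat.exists_norm_hermiteCoeff_div_le {f₀ : RSp d → ℂ}
    (hf₀ : IsPilipovicFlat 1 f₀) : ∃ C R : ℝ, 0 < R ∧
      ∀ α, ‖hermiteCoeff f₀ α / (hermiteNorm α : ℂ)‖ ≤ C * R ^ (∑ j, α j) := by
  obtain ⟨-, r, hr, C, hC⟩ := hf₀
  have hr_sum : 0 ≤ ∑ j, r j := Finset.sum_nonneg fun j _ => (hr j).le
  have hC_nonneg : 0 ≤ C := by simpa using (norm_nonneg _).trans (hC 0)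
  refine ⟨C, (1 + ∑ j, r j) / 2 ^ (-(1 / 2) : ℝ), by positivity, fun α => ?_⟩
  have hle_sum (j : Fin d) : r j ≤ 1 + ∑ i, r i :=
    (Finset.single_le_sum (fun i _ => (hr i).le) (Finset.mem_univ j)).trans (by simp)
  rw [norm_div, Complex.norm_real, Real.norm_of_nonneg (hermiteNorm_pos α).le,
    div_le_iff₀ (hermiteNorm_pos α), hermiteNorm_eq]
  refine (hC α).trans ?_
  rw [mul_one, mul_assoc C, ← mul_assoc (_ ^ _), ← mul_pow, div_mul_cancel₀ _ (by positivity),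
    ← Finset.prod_pow_eq_pow_sum]
  gcongr with j
  · exact fun j _ => pow_nonneg (hr j).le _
  · exact (hr j).le
  · exact hle_sum j

theorem exists_polydisc_of_memPilipovicFlat
    {f : Module.Dual ℂ (gelfandShilov (1 / 2) (RSp d))} (hf : MemPilipovicFlat 1 f) :
    ∃ F : RSp d × RSp d → ℂ, IsBoundedCompactlySupported F ∧
        (∃ r : Fin d → ℝ, (∀ j, 0 < r j) ∧
          ∃ F₀ : (Fin d → ℂ) → ℂ, AnalyticOnNhd ℂ F₀ (closedPolydisc r) ∧
            ∀ x ξ : RSp d, F (x, ξ) =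
              F₀ (fun j => (x j : ℂ) - Complex.I * (ξ j : ℂ)) *
                Complex.exp (-Complex.I * (inner ℝ x ξ : ℝ)) * polydiscChar r (x, ξ)) ∧
        IsStftAdjointFun (gaussianWindow d) F f := by
  obtain ⟨f₀, hf₀, hf⟩ := hf
  obtain ⟨C, R, hR, ha⟩ := hf₀.exists_norm_hermiteCoeff_div_le
  obtain ⟨ρ, G, hρ, hG, hmoments⟩ := exists_analyticOnNhd_twisted_moments hR ha (-1 / 8)
  rw [← closedPolydisc_const hρ.le] at hG hmoments
  have hF₀ := hG.mul (analyticOnNhd_cexp_sum_sq (-1 / 8) _)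
  have hbdd := isBoundedCompactlySupported_polydiscFun hF₀.continuousOn
  refine ⟨_, hbdd, ⟨_, fun _ => hρ, _, hF₀, fun x ξ => rfl⟩,
    isStftAdjointFun_of_hermiteCoeff hbdd hf₀.1 hf fun α => ?_⟩
  have hnorm : (hermiteNorm α : ℂ) ≠ 0 := by exact_mod_cast (hermiteNorm_pos α).ne'
  rw [integral_polydiscFun_mul_laplaceTransform, ← mul_div_cancel₀ (hermiteCoeff f₀ α) hnorm,
    ← hmoments α]
  congr 2 with w
  have hcancel : Complex.exp (-1 / 8 * ∑ j, star w j ^ 2) *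
      Complex.exp ((∑ j, star w j ^ 2) / 8) = 1 := by
    rw [← Complex.exp_add, show _ + _ = (0 : ℂ) by ring, Complex.exp_zero]
  linear_combination (G (star w) * radialGaussian w * ((∏ j, w j ^ α j) *
    Complex.exp (-1 / 8 * ∑ j, w j ^ 2))) * hcancel

end Polydisc

end

theorem mainTheorem10_general (d : ℕ) (s : ℝ) (hs : 1 ≤ s)
    (f : Module.Dual ℂ (gelfandShilov (1 / 2) (RSp d))) :
    List.TFAE [
      MemPilipovicFlat 1 f,
      ∃ F ∈ gevreyDual s (RSp d × RSp d), IsStftAdjoint (gaussianWindow d) F f,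
      ∃ F : RSp d × RSp d → ℂ, IsBoundedCompactlySupported F ∧
        IsStftAdjointFun (gaussianWindow d) F f,
      ∃ F : RSp d × RSp d → ℂ, IsBoundedCompactlySupported F ∧
        (∃ r : Fin d → ℝ, (∀ j, 0 < r j) ∧
          ∃ F₀ : (Fin d → ℂ) → ℂ, AnalyticOnNhd ℂ F₀ (closedPolydisc r) ∧
            ∀ x ξ : RSp d, F (x, ξ) =
              F₀ (fun j => (x j : ℂ) - Complex.I * (ξ j : ℂ)) *
                Complex.exp (-Complex.I * (inner ℝ x ξ : ℝ)) * polydiscChar r (x, ξ)) ∧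
        IsStftAdjointFun (gaussianWindow d) F f] := by
  tfae_have 1 → 4 := exists_polydisc_of_memPilipovicFlat
  tfae_have 4 → 3 := fun ⟨F, hF, _, h⟩ => ⟨F, hF, h⟩
  tfae_have 3 → 2 := fun ⟨_, hF, h⟩ =>
    ⟨functionDual s hF, functionDual_mem_gevreyDual s hF, h.isStftAdjoint hs hF⟩
  tfae_have 2 → 1 := fun ⟨_, hF, h⟩ => memPilipovicFlat_of_isStftAdjoint hs hF h
  tfae_finish

theorem mainTheorem10 (d : ℕ) (s : ℝ) (hs : 1 < s)
    (f : Module.Dual ℂ (gelfandShilov (1 / 2) (RSp d)))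
    (hf : f ∈ gelfandShilovDual (1 / 2) (RSp d)) :
    List.TFAE [
      MemPilipovicFlat 1 f,
      ∃ F ∈ gevreyDual s (RSp d × RSp d), IsStftAdjoint (gaussianWindow d) F f,
      ∃ F : RSp d × RSp d → ℂ, IsBoundedCompactlySupported F ∧
        IsStftAdjointFun (gaussianWindow d) F f,
      ∃ F : RSp d × RSp d → ℂ, IsBoundedCompactlySupported F ∧
        (∃ r : Fin d → ℝ, (∀ j, 0 < r j) ∧
          ∃ F₀ : (Fin d → ℂ) → ℂ, AnalyticOnNhd ℂ F₀ (closedPolydisc r) ∧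
            ∀ x ξ : RSp d, F (x, ξ) =
              F₀ (fun j => (x j : ℂ) - Complex.I * (ξ j : ℂ)) *
                Complex.exp (-Complex.I * (inner ℝ x ξ : ℝ)) * polydiscChar r (x, ξ)) ∧
        IsStftAdjointFun (gaussianWindow d) F f] :=
  mainTheorem10_general d s hs.le f
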